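/- Let $(\breve N,\breve g)$ be a (Hausdorff, smooth, finite-dimensional) semi-Riemannian manifold with Levi-Civita connection $\breve\nabla$, let $p,q$ be positive integers, and let $\breve J$ be a smooth $(1,1)$-tensor field on $\breve N$ with $\breve J^2=p\breve J+qI$, $\breve g(\breve JU,V)=\breve g(U,\breve JV)$ and $\breve\nabla\breve J=0$ (a locally metallic semi-Riemannian manifold). Let $M$ be an immersed (Hausdorff) lightlike submanifold of dimension $m$ and codimension $k$: $\mathrm{Rad}(TM)=TM\cap TM^\perp$ has constant rank $r$ with $1\le r\le m$. Fix a screen distribution $S(TM)$ (a non-degenerate complement of $\mathrm{Rad}(TM)$ in $TM$), a screen transversal bundle $S(TM^\perp)$ (a non-degenerate complement of $\mathrm{Rad}(TM)$ in $TM^\perp$), and a lightlike transversal bundle $\mathrm{ltr}(TM)$: a subbundle orthogonal to $S(TM)$ and $S(TM^\perp)$ which locally has a frame $\{\eta_i\}$ with $\breve g(\eta_i,\xi_j)=\delta_{ij}$, $\breve g(\eta_i,\eta_j)=0$ for a local frame $\{\xi_j\}$ of $\mathrm{Rad}(TM)$. Then $T\breve N|_M=TM\oplus \mathrm{ltr}(TM)\oplus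 S(TM^\perp)$. For vector fields $W,U$ on $M$, $Z\in\Gamma(S(TM^\perp))$ and $\eta\in\Gamma(\mathrm{ltr}(TM))$ let $h(W,U)$ be the component of $\breve\nabla_WU$ in $\mathrm{ltr}(TM)\oplus S(TM^\perp)$, $D^l(W,Z)$ the component of $\breve\nabla_WZ$ in $\mathrm{ltr}(TM)$, and $D^s(W,\eta)$ the component of $\breve\nabla_W\eta$ in $S(TM^\perp)$. $M$ is totally geodesic if $h=0$. Assume that $M$ is isotropic ($r=m<k$ and $S(TM)=\{0\}$, so $TM=\mathrm{Rad}(TM)$) and screen transversal ($\breve J\,\mathrm{Rad}(TM)\subset S(TM^\perp)$). Let $D_0$ be the orthogonal complement in $S(TM^\perp)$ of $\breve J\,\mathrm{Rad}(TM)$ and $\breve J\,\mathrm{ltr}(TM)$, i.e. the set of all $Z\in S(TM^\perp)$ with $\breve g(Z,\breve J\xi)=0$ and $\breve g(Z,\breve J\eta)=0$ for all $\xi\in\mathrm{Rad}(TM)$, $\eta\in\mathrm{ltr}(TM)$. Theorem. $M$ is totally geodesic if and only if for all $\xi_1,\xi_2\in\Gamma(\mathrm{Rad}(TM))$, $\eta\in\Gamma(\mathrm{ltr}(TM))$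 and $Z\in\Gamma(D_0)$: (1) $D^l(\xi_1,\breve J\xi_2)=0$; (2) $D^l(\xi_1,Z)=0$; (3) $D^s(\xi_1,\eta)$ has no component along $\breve J\,\mathrm{Rad}(TM)$ with respect to the metric, i.e. $\breve g(D^s(\xi_1,\eta),\breve J\xi)=0$ for every $\xi\in\mathrm{Rad}(TM)$. -/

import Mathlib

open Set Module
open scoped Manifold ContDiff Topology

/-! ## Linear algebra of the transversal decomposition -/

/-- Let `B` be a nondegenerate symmetric form, `R = T ∩ T^⊥` the radical of `T`, `S` a complement
of `R` in `T^⊥`, and `L` a space with a basis dual to a basis of `R`.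
Then `T`, `L`, `S` are independent. -/
theorem lightlike_indep {V : Type*} [AddCommGroup V] [Module ℝ V]
    {B : V → V → ℝ} (hadd : ∀ u v w, B (u + v) w = B u w + B v w)
    (hsm : ∀ (c : ℝ) v w, B (c • v) w = c * B v w) (hsymm : ∀ u v, B u v = B v u)
    {T P R S L : Submodule ℝ V} (hP : ∀ u, u ∈ P ↔ ∀ v ∈ T, B u v = 0) (hR : R = T ⊓ P)
    (hSR : S ⊓ R = ⊥) (hSP : S ⊔ R = P) {r : ℕ} {ξ N : Fin r → V}
    (hξ : Submodule.span ℝ (range ξ) = R) (hN : Submodule.span ℝ (range N) = L)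
    (hd : ∀ i j, B (N i) (ξ j) = if i = j then 1 else 0) {t l s : V} (ht : t ∈ T) (hl : l ∈ L)
    (hs : s ∈ S) (h : t + l + s = 0) : t = 0 ∧ l = 0 ∧ s = 0 := by
  have hsP : s ∈ P := hSP ▸ (le_sup_left : S ≤ S ⊔ R) hs
  have hξR : ∀ j, ξ j ∈ T ⊓ P := fun j => by
    rw [← hR, ← hξ]; exact Submodule.subset_span ⟨j, rfl⟩
  have hB0 : ∀ w, B 0 w = 0 := fun w => by simpa using hsm 0 0 w
  have hl0 : l = 0 := by
    rw [← hN, Submodule.mem_span_range_iff_exists_fun] at hl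
    obtain ⟨c, rfl⟩ := hl
    have hc : ∀ j, c j = 0 := by
      intro j
      have hlin : ∀ σ : Finset (Fin r), B (∑ i ∈ σ, c i • N i) (ξ j) =
          ∑ i ∈ σ, c i * B (N i) (ξ j) := by
        classical
        intro σ
        induction σ using Finset.induction_on with
        | empty => simpa using hB0 _
        | insert a σ ha ih => rw [Finset.sum_insert ha, Finset.sum_insert ha, hadd, hsm, ih]
      have h1 : B (t + ∑ i, c i • N i + s) (ξ j) = 0 := by rw [h]; exact hB0 _
      rw [hadd, hadd, hlin, hsymm t, (hP _).1 (hξR j).2 t ht, (hP _).1 hsP _ (hξR j).1] at h1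
      simpa [hd] using h1
    simp [hc]
  subst hl0
  have hts : t = -s := by rw [add_zero] at h; exact eq_neg_of_add_eq_zero_left h
  have hsR : s ∈ S ⊓ R := ⟨hs, by
    rw [hR]; exact ⟨by have := T.neg_mem ht; rwa [hts, neg_neg] at this, hsP⟩⟩
  rw [hSR, Submodule.mem_bot] at hsR
  exact ⟨by rw [hts, hsR, neg_zero], rfl, hsR⟩

/-- In the same situation, `T`, `L` and `S` span the whole space. -/
theorem lightlike_span {V : Type*} [AddCommGroup V] [Module ℝ V] [FiniteDimensional ℝ V]
    {B : LinearMap.BilinForm ℝ V} (hB : B.Nondegenerate) (hsymm : ∀ u v, B u v = B v u)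
    {T P R S L : Submodule ℝ V} (hP : ∀ u, u ∈ P ↔ ∀ v ∈ T, B u v = 0) (hR : R = T ⊓ P)
    (hSR : S ⊓ R = ⊥) (hSP : S ⊔ R = P) {r : ℕ} {ξ N : Fin r → V} (hξi : LinearIndependent ℝ ξ)
    (hξ : Submodule.span ℝ (range ξ) = R) (hNi : LinearIndependent ℝ N)
    (hN : Submodule.span ℝ (range N) = L)
    (hd : ∀ i j, B (N i) (ξ j) = if i = j then 1 else 0) : T ⊔ L ⊔ S = ⊤ := by
  have ind := fun {t l s : V} => lightlike_indep (B := fun u v => B u v) (t := t) (l := l) (s := s)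
    (by simp) (by simp) hsymm hP hR hSR hSP hξ hN hd
  have hPo : P = B.orthogonal T := by
    ext u
    rw [hP, LinearMap.BilinForm.mem_orthogonal_iff]
    exact forall₂_congr fun v _ => by rw [hsymm u v]
  have hdP : finrank ℝ P = finrank ℝ V - finrank ℝ T := by
    rw [hPo]; exact LinearMap.BilinForm.finrank_orthogonal hB T
  have hT : finrank ℝ T ≤ finrank ℝ V := Submodule.finrank_le T
  have hdR : finrank ℝ R = r := by rw [← hξ, finrank_span_eq_card hξi]; simp
  have hdL : finrank ℝ L = r := by rw [← hN, finrank_span_eq_card hNi]; simp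
  have e1 := Submodule.finrank_sup_add_finrank_inf_eq S R
  rw [hSR, hSP, finrank_bot] at e1
  have i1 : T ⊓ L = ⊥ := by
    rw [Submodule.eq_bot_iff]
    rintro v ⟨hv, hv'⟩
    exact (ind hv (L.neg_mem hv') S.zero_mem (by simp)).1
  have i2 : (T ⊔ L) ⊓ S = ⊥ := by
    rw [Submodule.eq_bot_iff]
    rintro v ⟨hv, hv'⟩
    obtain ⟨t, ht, l, hl, rfl⟩ := Submodule.mem_sup.1 hv
    have := ind ht hl (S.neg_mem hv') (by simp)
    rw [this.1, this.2.1, add_zero]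
  have e2 := Submodule.finrank_sup_add_finrank_inf_eq T L
  have e3 := Submodule.finrank_sup_add_finrank_inf_eq (T ⊔ L) S
  rw [i1, finrank_bot] at e2
  rw [i2, finrank_bot] at e3
  exact Submodule.eq_top_of_finrank_eq (by omega)

noncomputable section

/-! ## Semi-Riemannian manifolds, Levi-Civita connection, metallic structures -/

section Ambient

variable (E : Type*) [NormedAddCommGroup E] [NormedSpace ℝ E]
  (N : Type*) [TopologicalSpace N] [ChartedSpace E N] [IsManifold 𝓘(ℝ, E) ∞ N]

/-- A semi-Riemannian metric: a smooth field of nondegenerate symmetric bilinear forms on the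
tangent spaces, of constant index. -/
structure SemiRiemannianMetric where
  /-- the bilinear form on `T_p N` -/
  val (p : N) : TangentSpace 𝓘(ℝ, E) p →L[ℝ] TangentSpace 𝓘(ℝ, E) p →L[ℝ] ℝ
  symm (p : N) (u v : TangentSpace 𝓘(ℝ, E) p) : val p u v = val p v u
  nondegenerate (p : N) (u : TangentSpace 𝓘(ℝ, E) p) : (∀ v, val p u v = 0) → u = 0
  contMDiff : ContMDiff 𝓘(ℝ, E) (𝓘(ℝ, E).prod 𝓘(ℝ, E →L[ℝ] E →L[ℝ] ℝ)) ∞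
    (fun p => Bundle.TotalSpace.mk' (E →L[ℝ] E →L[ℝ] ℝ) p (val p))
  /-- the index: the largest dimension of a negative definite subspace of `T_p N` -/
  index : ℕ
  isGreatest_index (p : N) : IsGreatest {d : ℕ | ∃ W : Submodule ℝ (TangentSpace 𝓘(ℝ, E) p),
    finrank ℝ W = d ∧ ∀ v ∈ W, v ≠ 0 → val p v v < 0} index

/-- A metallic structure: a smooth `(1,1)`-tensor field `J` with `J² = pJ + qI`, where `p` and `q`
are positive integers. -/
structure MetallicStructure (p q : ℕ) where
  /-- the endomorphism of `T_x N` -/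
  val (x : N) : TangentSpace 𝓘(ℝ, E) x →L[ℝ] TangentSpace 𝓘(ℝ, E) x
  contMDiff : ContMDiff 𝓘(ℝ, E) (𝓘(ℝ, E).prod 𝓘(ℝ, E →L[ℝ] E)) ∞
    (fun x => Bundle.TotalSpace.mk' (E →L[ℝ] E) x (val x))
  p_pos : 0 < p
  q_pos : 0 < q
  sq (x : N) (v : TangentSpace 𝓘(ℝ, E) x) : val x (val x v) = (p : ℝ) • val x v + (q : ℝ) • v

end Ambient

section Along

variable {E : Type*} [NormedAddCommGroup E] [NormedSpace ℝ E]
  {N : Type*} [TopologicalSpace N] [ChartedSpace E N] [IsManifold 𝓘(ℝ, E) ∞ N]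
  {F : Type*} [NormedAddCommGroup F] [NormedSpace ℝ F]
  {M : Type*} [TopologicalSpace M] [ChartedSpace F M] [IsManifold 𝓘(ℝ, F) ∞ M]

/-- The preferred trivialization of `TN` at `p` (coming from the chart at `p`) is the identity on
the fibre over `p`, so that vectors of `T_p N` are their own coordinate vectors in this chart. -/
theorem trivializationAt_tangent_self (p : N) (v : TangentSpace 𝓘(ℝ, E) p) :
    (trivializationAt E (TangentSpace 𝓘(ℝ, E)) p ⟨p, v⟩).2 = v :=
  (tangentBundleCore 𝓘(ℝ, E) N).coordChange_self (achart E p) p (mem_achart_source E p) v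

namespace SemiRiemannianMetric

variable (g : SemiRiemannianMetric E N)

/-- The metric at `p` as a bilinear form. -/
def bilin (p : N) : LinearMap.BilinForm ℝ (TangentSpace 𝓘(ℝ, E) p) :=
  LinearMap.mk₂ ℝ (fun u v => g.val p u v) (by simp) (by simp) (by simp) (by simp)

theorem bilin_apply (p : N) (u v : TangentSpace 𝓘(ℝ, E) p) : g.bilin p u v = g.val p u v := rfl

theorem bilin_nondegenerate (p : N) : (g.bilin p).Nondegenerate :=
  ⟨fun u hu => g.nondegenerate p u hu,
    fun u hu => g.nondegenerate p u fun v => by rw [g.symm]; exact hu v⟩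

/-- The matrix of the metric in the chart at `p`: `chartForm p z u v` is the value of `g` on the
two constant coordinate vector fields `u`, `v`, at the point with coordinates `z`. -/
def chartForm (p : N) (z : E) : E →L[ℝ] E →L[ℝ] ℝ :=
  let y : N := (extChartAt 𝓘(ℝ, E) p).symm z
  let A : E →L[ℝ] E := (trivializationAt E (TangentSpace 𝓘(ℝ, E)) p).symmL ℝ y
  let B : E →L[ℝ] E →L[ℝ] ℝ := g.val y
  B.bilinearComp A A

/-- The derivative at `p` of the metric in the chart at `p`:
`chartFormDeriv p w u v = ∂_w (g (u, v))`. -/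
def chartFormDeriv (p : N) : E →L[ℝ] E →L[ℝ] E →L[ℝ] ℝ :=
  fderiv ℝ (g.chartForm p) (extChartAt 𝓘(ℝ, E) p p)

/-- The Christoffel symbols of the first kind at `p`, in the chart at `p`:
`w ↦ (∂_u g(v, w) + ∂_v g(u, w) - ∂_w g(u, v)) / 2`. -/
def christoffelFirst (p : N) (u v : E) : E →L[ℝ] ℝ :=
  (1 / 2 : ℝ) • (g.chartFormDeriv p u v + g.chartFormDeriv p v u -
    ((g.chartFormDeriv p).flip u).flip v)

theorem christoffelFirst_apply (p : N) (u v w : E) :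
    g.christoffelFirst p u v w = (g.chartFormDeriv p u v w + g.chartFormDeriv p v u w -
      g.chartFormDeriv p w u v) / 2 := by
  simp [christoffelFirst]; ring

variable [FiniteDimensional ℝ E]

instance (p : N) : FiniteDimensional ℝ (TangentSpace 𝓘(ℝ, E) p) :=
  inferInstanceAs (FiniteDimensional ℝ E)

/-- The Christoffel symbols (of the second kind) of the Levi-Civita connection at `p` in the chart
at `p`: the vector `Γ(u, v)` with `g (Γ(u, v), w) = christoffelFirst p u v w` for all `w`. -/
def christoffel (p : N) (u v : TangentSpace 𝓘(ℝ, E) p) : TangentSpace 𝓘(ℝ, E) p :=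
  ((g.bilin p).toDual (g.bilin_nondegenerate p)).symm
    (show TangentSpace 𝓘(ℝ, E) p →ₗ[ℝ] ℝ from (g.christoffelFirst p u v : E →ₗ[ℝ] ℝ))

theorem christoffel_spec (p : N) (u v w : TangentSpace 𝓘(ℝ, E) p) :
    g.val p (g.christoffel p u v) w = g.christoffelFirst p u v w := by
  rw [← g.bilin_apply, christoffel, LinearMap.BilinForm.apply_toDual_symm_apply]
  rfl

/-- The Levi-Civita connection of `g`, acting on a vector field `V` along a map `f : M → N` and
evaluated on `w ∈ T_x M`; in coordinates `(∇_w V)^k = ∂_w V^k + Γ^k_{ij} (df w)^i V^j`.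
For `f = id` this is the Levi-Civita connection of `N` on vector fields; if `V = U ∘ f` with a
vector field `U` on `N`, it is `∇_{df w} U`. -/
def nablaAlong (f : M → N) (V : ∀ x : M, TangentSpace 𝓘(ℝ, E) (f x)) (x : M)
    (w : TangentSpace 𝓘(ℝ, F) x) : TangentSpace 𝓘(ℝ, E) (f x) :=
  (show TangentSpace 𝓘(ℝ, E) (f x) from
    mfderiv 𝓘(ℝ, F) 𝓘(ℝ, E)
      (fun y => (trivializationAt E (TangentSpace 𝓘(ℝ, E)) (f x) ⟨f y, V y⟩).2) x w) +
    g.christoffel (f x) (mfderiv 𝓘(ℝ, F) 𝓘(ℝ, E) f x w) (V x)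

end SemiRiemannianMetric

/-- Smoothness on a set `U ⊆ M` of a vector field along `f : M → N`. -/
def IsSmoothAlongOn (f : M → N) (V : ∀ x : M, TangentSpace 𝓘(ℝ, E) (f x)) (U : Set M) : Prop :=
  ContMDiffOn 𝓘(ℝ, F) 𝓘(ℝ, E).tangent ∞ (fun x => (⟨f x, V x⟩ : TangentBundle 𝓘(ℝ, E) N)) U

/-- A (global) smooth vector field on `M`. -/
def IsVectorField (W : ∀ x : M, TangentSpace 𝓘(ℝ, F) x) : Prop :=
  ContMDiff 𝓘(ℝ, F) 𝓘(ℝ, F).tangent ∞ (fun x => (⟨x, W x⟩ : TangentBundle 𝓘(ℝ, F) M))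

/-- A smooth local frame over `U`, consisting of `n` sections, of a family `S` of subspaces of the
tangent spaces of `N` along `f`. -/
def IsFrameOn (f : M → N) (S : ∀ x : M, Submodule ℝ (TangentSpace 𝓘(ℝ, E) (f x))) (U : Set M)
    {n : ℕ} (e : Fin n → ∀ x : M, TangentSpace 𝓘(ℝ, E) (f x)) : Prop :=
  (∀ i, IsSmoothAlongOn (F := F) f (e i) U) ∧
    ∀ x ∈ U, LinearIndependent ℝ (fun i => e i x) ∧
      Submodule.span ℝ (range fun i => e i x) = S x

/-- `S` is a smooth vector subbundle of `f^* TN`. -/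
def IsSubbundle (f : M → N) (S : ∀ x : M, Submodule ℝ (TangentSpace 𝓘(ℝ, E) (f x))) : Prop :=
  ∀ x : M, ∃ U : Set M, IsOpen U ∧ x ∈ U ∧ ∃ (n : ℕ)
    (e : Fin n → ∀ x : M, TangentSpace 𝓘(ℝ, E) (f x)), IsFrameOn (F := F) f S U e

/-- `V ∈ Γ(S)`: `V` is a smooth section of `S`. -/
def IsSectionOf (f : M → N) (S : ∀ x : M, Submodule ℝ (TangentSpace 𝓘(ℝ, E) (f x)))
    (V : ∀ x : M, TangentSpace 𝓘(ℝ, E) (f x)) : Prop :=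
  IsSmoothAlongOn (F := F) f V univ ∧ ∀ x, V x ∈ S x

namespace MetallicStructure

variable {p q : ℕ} (J : MetallicStructure E N p q) (g : SemiRiemannianMetric E N)

/-- `g(JW, U) = g(W, JU)`; then `(N, g, J)` is a metallic semi-Riemannian manifold. -/
def IsCompatible : Prop :=
  ∀ (x : N) (u v : TangentSpace 𝓘(ℝ, E) x), g.val x (J.val x u) v = g.val x u (J.val x v)

/-- `J` is parallel: `∇_W (JU) = J ∇_W U` for all vector fields `W`, `U` on `N`. -/
def IsParallel [FiniteDimensional ℝ E] : Prop :=
  ∀ W U : (∀ x : N, TangentSpace 𝓘(ℝ, E) x), IsVectorField W → IsVectorField U → ∀ x,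
    g.nablaAlong (F := E) (fun y : N => y) (fun y => J.val y (U y)) x (W x) =
      J.val x (g.nablaAlong (F := E) (fun y : N => y) U x (W x))

/-- `(N, g, J)` is a locally metallic semi-Riemannian manifold. -/
def IsLocallyMetallic [FiniteDimensional ℝ E] : Prop := J.IsCompatible g ∧ J.IsParallel g

end MetallicStructure

/-! ## Lightlike submanifolds -/

/-- `T_x M` as a subspace of `T_{f x} N`. -/
def tangentAlong (f : M → N) (x : M) : Submodule ℝ (TangentSpace 𝓘(ℝ, E) (f x)) :=
  LinearMap.range (mfderiv 𝓘(ℝ, F) 𝓘(ℝ, E) f x : TangentSpace 𝓘(ℝ, F) x →ₗ[ℝ]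
    TangentSpace 𝓘(ℝ, E) (f x))

/-- `T_x M^⊥`. -/
def normalAlong (g : SemiRiemannianMetric E N) (f : M → N) (x : M) :
    Submodule ℝ (TangentSpace 𝓘(ℝ, E) (f x)) where
  carrier := {u | ∀ v ∈ tangentAlong (F := F) f x, g.val (f x) u v = 0}
  add_mem' hu hv w hw := by simp [hu w hw, hv w hw]
  zero_mem' w _ := by simp
  smul_mem' c u hu w hw := by simp [hu w hw]

/-- The radical `Rad(T_x M) = T_x M ∩ T_x M^⊥`. -/
def radAlong (g : SemiRiemannianMetric E N) (f : M → N) (x : M) :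
    Submodule ℝ (TangentSpace 𝓘(ℝ, E) (f x)) :=
  tangentAlong (F := F) f x ⊓ normalAlong (F := F) g f x

variable (F M) in
/-- A lightlike submanifold `(M, g, S(TM), S(TM^⊥))` of `(N, g)`, immersed by `toFun`, together
with a lightlike transversal bundle `ltr(TM)`. -/
structure LightlikeSubmanifold (g : SemiRiemannianMetric E N) where
  /-- the immersion -/
  toFun : M → N
  contMDiff : ContMDiff 𝓘(ℝ, F) 𝓘(ℝ, E) ∞ toFun
  injective (x : M) : Function.Injective (mfderiv 𝓘(ℝ, F) 𝓘(ℝ, E) toFun x)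
  /-- the rank of the radical distribution -/
  r : ℕ
  one_le_r : 1 ≤ r
  r_le : r ≤ finrank ℝ F
  finrank_rad (x : M) : finrank ℝ (radAlong (F := F) g toFun x) = r
  /-- the screen distribution `S(TM)`, a semi-Riemannian complement of `Rad(TM)` in `TM` -/
  screen (x : M) : Submodule ℝ (TangentSpace 𝓘(ℝ, E) (toFun x))
  screen_subbundle : IsSubbundle (F := F) toFun screen
  screen_inf (x : M) : screen x ⊓ radAlong (F := F) g toFun x = ⊥
  screen_sup (x : M) : screen x ⊔ radAlong (F := F) g toFun x = tangentAlong (F := F) toFun x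
  screen_nondegenerate (x : M) : ∀ u ∈ screen x, (∀ v ∈ screen x, g.val _ u v = 0) → u = 0
  /-- the screen transversal bundle `S(TM^⊥)`, a semi-Riemannian complement of `Rad(TM)`
  in `TM^⊥` -/
  screenTr (x : M) : Submodule ℝ (TangentSpace 𝓘(ℝ, E) (toFun x))
  screenTr_subbundle : IsSubbundle (F := F) toFun screenTr
  screenTr_inf (x : M) : screenTr x ⊓ radAlong (F := F) g toFun x = ⊥
  screenTr_sup (x : M) :
    screenTr x ⊔ radAlong (F := F) g toFun x = normalAlong (F := F) g toFun x
  screenTr_nondegenerate (x : M) :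
    ∀ u ∈ screenTr x, (∀ v ∈ screenTr x, g.val _ u v = 0) → u = 0
  /-- the lightlike transversal bundle `ltr(TM)` -/
  ltr (x : M) : Submodule ℝ (TangentSpace 𝓘(ℝ, E) (toFun x))
  ltr_orthogonal_screen (x : M) : ∀ u ∈ ltr x, ∀ v ∈ screen x, g.val _ u v = 0
  ltr_orthogonal_screenTr (x : M) : ∀ u ∈ ltr x, ∀ v ∈ screenTr x, g.val _ u v = 0
  /-- locally `ltr(TM)` has a frame `η_i` with `g(η_i, ξ_j) = δ_ij` and `g(η_i, η_j) = 0`, for a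
  frame `ξ_j` of `Rad(TM)` -/
  ltr_frame (x : M) : ∃ U : Set M, IsOpen U ∧ x ∈ U ∧
    ∃ ξ η : Fin r → ∀ y : M, TangentSpace 𝓘(ℝ, E) (toFun y),
      IsFrameOn (F := F) toFun (radAlong (F := F) g toFun) U ξ ∧
      IsFrameOn (F := F) toFun ltr U η ∧
      ∀ y ∈ U, ∀ i j, g.val _ (η i y) (ξ j y) = (if i = j then 1 else 0) ∧
        g.val _ (η i y) (η j y) = 0

namespace LightlikeSubmanifold

variable {g : SemiRiemannianMetric E N} (S : LightlikeSubmanifold F M g)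

/-- `T_x M` inside `T_{f x} N`. -/
abbrev tan (x : M) : Submodule ℝ (TangentSpace 𝓘(ℝ, E) (S.toFun x)) :=
  tangentAlong (F := F) S.toFun x

/-- `Rad(TM)`. -/
abbrev rad (x : M) : Submodule ℝ (TangentSpace 𝓘(ℝ, E) (S.toFun x)) :=
  radAlong (F := F) g S.toFun x

/-- The transversal bundle `tr(TM) = ltr(TM) ⊕ S(TM^⊥)`. -/
def tr (x : M) : Submodule ℝ (TangentSpace 𝓘(ℝ, E) (S.toFun x)) := S.ltr x ⊔ S.screenTr x

theorem indep (x : M) {t l s : TangentSpace 𝓘(ℝ, E) (S.toFun x)} (ht : t ∈ S.tan x)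
    (hl : l ∈ S.ltr x) (hs : s ∈ S.screenTr x) (h : t + l + s = 0) : t = 0 ∧ l = 0 ∧ s = 0 := by
  obtain ⟨U, -, hx, ξ, η, hξ, hη, hd⟩ := S.ltr_frame x
  exact lightlike_indep (B := fun u v => g.val (S.toFun x) u v) (by simp) (by simp) (g.symm _)
    (P := normalAlong (F := F) g S.toFun x) (fun u => Iff.rfl) rfl (S.screenTr_inf x)
    (S.screenTr_sup x) (hξ.2 x hx).2 (hη.2 x hx).2 (fun i j => (hd x hx i j).1) ht hl hs h

variable [FiniteDimensional ℝ E]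

theorem sup_eq_top (x : M) : S.tan x ⊔ S.ltr x ⊔ S.screenTr x = ⊤ := by
  obtain ⟨U, -, hx, ξ, η, hξ, hη, hd⟩ := S.ltr_frame x
  exact lightlike_span (g.bilin_nondegenerate (S.toFun x)) (g.symm _)
    (P := normalAlong (F := F) g S.toFun x) (fun u => Iff.rfl) rfl (S.screenTr_inf x)
    (S.screenTr_sup x) (hξ.2 x hx).1 (hξ.2 x hx).2 (hη.2 x hx).1 (hη.2 x hx).2
    (fun i j => (hd x hx i j).1)

theorem isCompl_tr (x : M) : IsCompl (S.tr x) (S.tan x) := by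
  refine ⟨Submodule.disjoint_def.2 fun v hv hv2 => ?_, codisjoint_iff.2 ?_⟩
  · obtain ⟨l, hl, s, hs, rfl⟩ := Submodule.mem_sup.1 hv
    have := S.indep x ((S.tan x).neg_mem hv2) hl hs (by abel)
    rw [this.2.1, this.2.2, add_zero]
  · rw [← S.sup_eq_top x, tr, sup_comm, sup_assoc]

theorem isCompl_ltr (x : M) : IsCompl (S.ltr x) (S.tan x ⊔ S.screenTr x) := by
  refine ⟨Submodule.disjoint_def.2 fun v hv hv2 => ?_, codisjoint_iff.2 ?_⟩
  · obtain ⟨t, ht, s, hs, rfl⟩ := Submodule.mem_sup.1 hv2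
    have := S.indep x ht ((S.ltr x).neg_mem hv) hs (by abel)
    exact neg_eq_zero.1 this.2.1
  · rw [← S.sup_eq_top x, sup_left_comm, sup_assoc]

theorem isCompl_screenTr (x : M) : IsCompl (S.screenTr x) (S.tan x ⊔ S.ltr x) := by
  refine ⟨Submodule.disjoint_def.2 fun v hv hv2 => ?_, codisjoint_iff.2 ?_⟩
  · obtain ⟨t, ht, l, hl, rfl⟩ := Submodule.mem_sup.1 hv2
    have := S.indep x ht hl ((S.screenTr x).neg_mem hv) (by abel)
    rw [this.1, this.2.1, add_zero]
  · rw [← S.sup_eq_top x, sup_comm]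

/-- The projection of `T_{f x} N = T_x M ⊕ tr(TM)_x` onto `tr(TM)_x`. -/
def projTr (x : M) (v : TangentSpace 𝓘(ℝ, E) (S.toFun x)) : TangentSpace 𝓘(ℝ, E) (S.toFun x) :=
  Submodule.projection _ _ (S.isCompl_tr x) v

/-- The projection of `T_{f x} N = T_x M ⊕ ltr(TM)_x ⊕ S(TM^⊥)_x` onto `ltr(TM)_x`. -/
def projLtr (x : M) (v : TangentSpace 𝓘(ℝ, E) (S.toFun x)) : TangentSpace 𝓘(ℝ, E) (S.toFun x) :=
  Submodule.projection _ _ (S.isCompl_ltr x) v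

/-- The projection of `T_{f x} N = T_x M ⊕ ltr(TM)_x ⊕ S(TM^⊥)_x` onto `S(TM^⊥)_x`. -/
def projScreenTr (x : M) (v : TangentSpace 𝓘(ℝ, E) (S.toFun x)) :
    TangentSpace 𝓘(ℝ, E) (S.toFun x) :=
  Submodule.projection _ _ (S.isCompl_screenTr x) v

/-- A vector field on `M`, seen as a vector field along the immersion. -/
def push (W : ∀ x : M, TangentSpace 𝓘(ℝ, F) x) (x : M) : TangentSpace 𝓘(ℝ, E) (S.toFun x) :=
  mfderiv 𝓘(ℝ, F) 𝓘(ℝ, E) S.toFun x (W x)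

/-- The second fundamental form of the Gauss formula `∇̆_W U = ∇_W U + h(W, U)`. -/
def h (W U : ∀ x : M, TangentSpace 𝓘(ℝ, F) x) (x : M) : TangentSpace 𝓘(ℝ, E) (S.toFun x) :=
  S.projTr x (g.nablaAlong S.toFun (S.push U) x (W x))

/-- `D^l(W, Z)`, the `ltr(TM)`-part of `∇̆_W Z`, for `Z ∈ Γ(S(TM^⊥))`. -/
def Dl (W : ∀ x : M, TangentSpace 𝓘(ℝ, F) x) (Z : ∀ x : M, TangentSpace 𝓘(ℝ, E) (S.toFun x))
    (x : M) : TangentSpace 𝓘(ℝ, E) (S.toFun x) :=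
  S.projLtr x (g.nablaAlong S.toFun Z x (W x))

/-- `D^s(W, η)`, the `S(TM^⊥)`-part of `∇̆_W η`, for `η ∈ Γ(ltr(TM))`. -/
def Ds (W : ∀ x : M, TangentSpace 𝓘(ℝ, F) x) (η : ∀ x : M, TangentSpace 𝓘(ℝ, E) (S.toFun x))
    (x : M) : TangentSpace 𝓘(ℝ, E) (S.toFun x) :=
  S.projScreenTr x (g.nablaAlong S.toFun η x (W x))

/-- `M` is totally geodesic: `h(W, U) = 0` for all vector fields `W`, `U` on `M`. -/
def IsTotallyGeodesic : Prop :=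
  ∀ W U : (∀ x : M, TangentSpace 𝓘(ℝ, F) x), IsVectorField W → IsVectorField U →
    ∀ x, S.h W U x = 0

/-- `W ∈ Γ(Rad(TM))`: a vector field on `M` with values in the radical distribution. -/
def IsRadField (W : ∀ x : M, TangentSpace 𝓘(ℝ, F) x) : Prop :=
  IsVectorField W ∧ ∀ x, S.push W x ∈ S.rad x

/-- `M` is isotropic: `r = m < k` (with `m = dim M`, `m + k = dim N`) and `S(TM) = {0}`. -/
def IsIsotropic : Prop :=
  S.r = finrank ℝ F ∧ finrank ℝ F + finrank ℝ F < finrank ℝ E ∧ ∀ x, S.screen x = ⊥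

variable {p q : ℕ} (J : MetallicStructure E N p q)

/-- `M` is screen transversal: `J Rad(TM) ⊆ S(TM^⊥)`. -/
def IsScreenTransversal : Prop :=
  ∀ x, ∀ v ∈ S.rad x, J.val (S.toFun x) v ∈ S.screenTr x

/-- `D₀`: the orthogonal complement in `S(TM^⊥)` of `J Rad(TM)` and `J ltr(TM)`. -/
def D₀ (x : M) : Submodule ℝ (TangentSpace 𝓘(ℝ, E) (S.toFun x)) where
  carrier := {u | u ∈ S.screenTr x ∧
    (∀ v ∈ S.rad x, g.val _ u (J.val (S.toFun x) v) = 0) ∧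
    ∀ v ∈ S.ltr x, g.val _ u (J.val (S.toFun x) v) = 0}
  add_mem' hu hv := ⟨add_mem hu.1 hv.1, fun w hw => by simp [hu.2.1 w hw, hv.2.1 w hw],
    fun w hw => by simp [hu.2.2 w hw, hv.2.2 w hw]⟩
  zero_mem' := ⟨zero_mem _, by simp, by simp⟩
  smul_mem' c u hu := ⟨Submodule.smul_mem _ c hu.1, fun w hw => by simp [hu.2.1 w hw],
    fun w hw => by simp [hu.2.2 w hw]⟩

/-- The vector field `V` along `M` has no component along `J Rad(TM)` with respect to the metric:
`g(V, Jξ) = 0` for all `ξ ∈ Rad(TM)`. -/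
def HasNoJRadComponent (V : ∀ x : M, TangentSpace 𝓘(ℝ, E) (S.toFun x)) : Prop :=
  ∀ x, ∀ v ∈ S.rad x, g.val _ (V x) (J.val (S.toFun x) v) = 0

end LightlikeSubmanifold

end Along

end

/-! Since `M` is isotropic, `TM = Rad(TM)` is null. The trilinear form `g(∇_a b, c)` on `TM` is
symmetric in `a, b` (no torsion, modulo tangent vectors, which pair to zero with `TM`) and skew in
`b, c` (metric connection, null `TM`), so it vanishes. Hence `h` never has an `ltr(TM)`-part, and by
nondegeneracy of `S(TM^⊥)` total geodesy means `g(∇_W U, s) = 0` for all `s` in `S(TM^⊥)`.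

Each such `s` splits as `Z + Jt + Jl + t'` with `Z` in `D₀`, `t, t'` in `TM` and `l` in `ltr(TM)`.
The term `t'` is needed because `J ltr(TM)` lies in `TM^⊥` but may have a radical part. The pairing
with `t'` is zero by the first paragraph. As `J` is self-adjoint and parallel and the connection is
metric, the other three are `g(∇_W U, Jt) = g(∇_W JU, t)`, `g(∇_W U, Z) = -g(∇_W Z, U)`, `g(∇_W U,
Jη) = -g(∇_W η, JU)`, where `η` is a section through `l`. Only the `ltr(TM)`-part is visible to `TM`
in the first two, and only the `S(TM^⊥)`-part is visible to `JU` in the third, so these are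
conditions (1), (2), (3).

The geometric input is `SemiRiemannianMetric.mfderiv_metric`,
`MetallicStructure.IsParallel.nablaAlong` and `exists_symm_nablaAlong_push`, all obtained from the
coordinate formula of the connection; the splitting is `exists_D₀_section`. -/

set_option linter.unusedSectionVars false

noncomputable section

section Along

variable {E : Type*} [NormedAddCommGroup E] [NormedSpace ℝ E]
  {N : Type*} [TopologicalSpace N] [ChartedSpace E N] [IsManifold 𝓘(ℝ, E) ∞ N]
  {F : Type*} [NormedAddCommGroup F] [NormedSpace ℝ F]
  {M : Type*} [TopologicalSpace M] [ChartedSpace F M] [IsManifold 𝓘(ℝ, F) ∞ M]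

/-! ## Vector fields along a map -/

/-- Smoothness at a point of a vector field along `f : M → N`. -/
def IsSmoothAlongAt (f : M → N) (V : ∀ x : M, TangentSpace 𝓘(ℝ, E) (f x)) (x : M) : Prop :=
  ContMDiffAt 𝓘(ℝ, F) 𝓘(ℝ, E).tangent ∞ (fun x => (⟨f x, V x⟩ : TangentBundle 𝓘(ℝ, E) N)) x

/-- The coordinates of a vector field along `f` in the chart at `f x`. -/
def alongCoord (f : M → N) (V : ∀ x : M, TangentSpace 𝓘(ℝ, E) (f x)) (x y : M) : E :=
  (trivializationAt E (TangentSpace 𝓘(ℝ, E)) (f x) ⟨f y, V y⟩).2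

theorem alongCoord_self (f : M → N) (V : ∀ x : M, TangentSpace 𝓘(ℝ, E) (f x)) (x : M) :
    alongCoord f V x x = V x :=
  trivializationAt_tangent_self (f x) (V x)

section Smooth

variable {f : M → N} {V W : ∀ x : M, TangentSpace 𝓘(ℝ, E) (f x)} {x : M}

theorem IsSmoothAlongOn.smoothAt {U : Set M} (h : IsSmoothAlongOn (F := F) f V U)
    (hU : IsOpen U) (hx : x ∈ U) : IsSmoothAlongAt (F := F) f V x :=
  (h x hx).contMDiffAt (hU.mem_nhds hx)

theorem isSmoothAlongOn_of_forall {U : Set M} (h : ∀ x ∈ U, IsSmoothAlongAt (F := F) f V x) :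
    IsSmoothAlongOn (F := F) f V U := fun x hx => (h x hx).contMDiffWithinAt

theorem isSmoothAlongAt_iff : IsSmoothAlongAt (F := F) f V x ↔
    ContMDiffAt 𝓘(ℝ, F) 𝓘(ℝ, E) ∞ f x ∧ ContMDiffAt 𝓘(ℝ, F) 𝓘(ℝ, E) ∞ (alongCoord f V x) x :=
  Bundle.contMDiffAt_totalSpace

namespace IsSmoothAlongAt

theorem map (h : IsSmoothAlongAt (F := F) f V x) : ContMDiffAt 𝓘(ℝ, F) 𝓘(ℝ, E) ∞ f x :=
  (isSmoothAlongAt_iff.1 h).1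

theorem coord (h : IsSmoothAlongAt (F := F) f V x) :
    ContMDiffAt 𝓘(ℝ, F) 𝓘(ℝ, E) ∞ (alongCoord f V x) x :=
  (isSmoothAlongAt_iff.1 h).2

theorem congr (h : IsSmoothAlongAt (F := F) f V x) (e : ∀ᶠ y in 𝓝 x, W y = V y) :
    IsSmoothAlongAt (F := F) f W x :=
  ContMDiffAt.congr_of_eventuallyEq h (e.mono fun y hy => by simp only [hy])

end IsSmoothAlongAt

theorem eventually_mem_baseSet (h : ContinuousAt f x) :
    ∀ᶠ y in 𝓝 x, f y ∈ (trivializationAt E (TangentSpace 𝓘(ℝ, E)) (f x)).baseSet :=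
  h ((trivializationAt E (TangentSpace 𝓘(ℝ, E)) (f x)).open_baseSet.mem_nhds
    (FiberBundle.mem_baseSet_trivializationAt' (f x)))

theorem IsSmoothAlongAt.add (hV : IsSmoothAlongAt (F := F) f V x)
    (hW : IsSmoothAlongAt (F := F) f W x) :
    IsSmoothAlongAt (F := F) f (fun y => V y + W y) x := by
  refine isSmoothAlongAt_iff.2 ⟨hV.map, (hV.coord.add hW.coord).congr_of_eventuallyEq ?_⟩
  filter_upwards [eventually_mem_baseSet (E := E) hV.map.continuousAt] with y hy
  exact (Bundle.Trivialization.linear ℝ (trivializationAt E (TangentSpace 𝓘(ℝ, E)) (f x)) hy).map_add _ _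

theorem IsSmoothAlongAt.smul {c : M → ℝ} (hc : ContMDiffAt 𝓘(ℝ, F) 𝓘(ℝ, ℝ) ∞ c x)
    (hV : IsSmoothAlongAt (F := F) f V x) :
    IsSmoothAlongAt (F := F) f (fun y => c y • V y) x := by
  refine isSmoothAlongAt_iff.2 ⟨hV.map, (hc.smul hV.coord).congr_of_eventuallyEq ?_⟩
  filter_upwards [eventually_mem_baseSet (E := E) hV.map.continuousAt] with y hy
  exact (Bundle.Trivialization.linear ℝ (trivializationAt E (TangentSpace 𝓘(ℝ, E)) (f x)) hy).map_smul _ _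

theorem isSmoothAlongAt_zero (hf : ContMDiffAt 𝓘(ℝ, F) 𝓘(ℝ, E) ∞ f x) :
    IsSmoothAlongAt (E := E) (F := F) f (fun _ => 0) x := by
  refine isSmoothAlongAt_iff.2 ⟨hf, (contMDiffAt_const (c := (0 : E))).congr_of_eventuallyEq ?_⟩
  filter_upwards [eventually_mem_baseSet (E := E) hf.continuousAt] with y hy
  exact (Bundle.Trivialization.linear ℝ (trivializationAt E (TangentSpace 𝓘(ℝ, E)) (f x)) hy).map_zero

theorem IsSmoothAlongAt.sub (hV : IsSmoothAlongAt (F := F) f V x)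
    (hW : IsSmoothAlongAt (F := F) f W x) :
    IsSmoothAlongAt (F := F) f (fun y => V y - W y) x := by
  have := hV.add (hW.smul (c := fun _ => (-1 : ℝ)) contMDiffAt_const)
  simpa [sub_eq_add_neg] using this

theorem isSmoothAlongAt_sum {ι : Type*} (s : Finset ι)
    {V : ι → ∀ x : M, TangentSpace 𝓘(ℝ, E) (f x)} (hf : ContMDiffAt 𝓘(ℝ, F) 𝓘(ℝ, E) ∞ f x)
    (hV : ∀ i ∈ s, IsSmoothAlongAt (F := F) f (V i) x) :
    IsSmoothAlongAt (F := F) f (fun y => ∑ i ∈ s, V i y) x := by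
  classical
  induction s using Finset.induction_on with
  | empty => simpa using isSmoothAlongAt_zero hf
  | insert a s ha ih =>
    simp only [Finset.sum_insert ha]
    exact (hV a (Finset.mem_insert_self a s)).add
      (ih fun i hi => hV i (Finset.mem_insert_of_mem hi))

theorem IsSmoothAlongAt.metric (g : SemiRiemannianMetric E N)
    (hV : IsSmoothAlongAt (F := F) f V x) (hW : IsSmoothAlongAt (F := F) f W x) :
    ContMDiffAt 𝓘(ℝ, F) 𝓘(ℝ, ℝ) ∞ (fun y => g.val (f y) (V y) (W y)) x := by
  have : ContMDiffAt 𝓘(ℝ, F) (𝓘(ℝ, E).prod 𝓘(ℝ, ℝ)) ∞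
      (fun m => Bundle.TotalSpace.mk' ℝ (E := Bundle.Trivial N ℝ) (f m)
        (g.val (f m) (V m) (W m))) x := by
    apply ContMDiffAt.clm_bundle_apply₂ (F₁ := E) (F₂ := E)
    · exact (g.contMDiff (f x)).comp x hV.map
    · exact hV
    · exact hW
  exact (Bundle.contMDiffAt_totalSpace.1 this).2

theorem IsSmoothAlongAt.metallic {p q : ℕ} (J : MetallicStructure E N p q)
    (hV : IsSmoothAlongAt (F := F) f V x) :
    IsSmoothAlongAt (F := F) f (fun y => J.val (f y) (V y)) x := by
  apply ContMDiffAt.clm_bundle_apply (F₁ := E) (F₂ := E)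
  · exact (J.contMDiff (f x)).comp x hV.map
  · exact hV

theorem isSmoothAlongAt_push {f : M → N} (hf : ContMDiff 𝓘(ℝ, F) 𝓘(ℝ, E) ∞ f)
    {U : ∀ x : M, TangentSpace 𝓘(ℝ, F) x} {x : M}
    (hU : IsSmoothAlongAt (F := F) (fun y : M => y) U x) :
    IsSmoothAlongAt (F := F) f (fun y => mfderiv 𝓘(ℝ, F) 𝓘(ℝ, E) f y (U y)) x :=
  ((hf.contMDiff_tangentMap (m := ∞) (by simp)) _).comp x hU

/-- The vector field on `N` with constant coordinates in the chart at `p`. -/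
def constField (p : N) (v : E) (y : N) : TangentSpace 𝓘(ℝ, E) y :=
  (trivializationAt E (TangentSpace 𝓘(ℝ, E)) p).symm y v

theorem alongCoord_constField {p y : N} (v : E)
    (hy : y ∈ (trivializationAt E (TangentSpace 𝓘(ℝ, E)) p).baseSet) :
    alongCoord (fun y : N => y) (constField p v) p y = v := by
  rw [alongCoord, constField, Bundle.Trivialization.apply_mk_symm _ hy]

/-- Smoothness at `y` is tested in the trivialization centred at `p` instead of `y`, where the
coordinates are constant. -/
theorem isSmoothAlongAt_constField {p y : N} (v : E)
    (hy : y ∈ (trivializationAt E (TangentSpace 𝓘(ℝ, E)) p).baseSet) :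
    IsSmoothAlongAt (F := E) (fun y : N => y) (constField p v) y := by
  refine ((trivializationAt E (TangentSpace 𝓘(ℝ, E)) p).contMDiffAt_iff (IB := 𝓘(ℝ, E)) ?_).2
    ⟨contMDiffAt_id, (contMDiffAt_const (c := v)).congr_of_eventuallyEq ?_⟩
  · exact (Bundle.Trivialization.mem_source _).2 hy
  · filter_upwards [(trivializationAt E (TangentSpace 𝓘(ℝ, E)) p).open_baseSet.mem_nhds hy]
      with z hz
    exact alongCoord_constField v hz

theorem constField_self (p : N) (v : E) : constField p v p = v := by
  have := alongCoord_constField (p := p) (v : E) (FiberBundle.mem_baseSet_trivializationAt' p)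
  rwa [alongCoord_self] at this

end Smooth

/-- A vector field along `f`, smooth on a neighbourhood of `x`, agrees near `x` with a global one. -/
theorem exists_global_extension [FiniteDimensional ℝ F] [T2Space M] {f : M → N}
    (hf : ContMDiff 𝓘(ℝ, F) 𝓘(ℝ, E) ∞ f) {V : ∀ x : M, TangentSpace 𝓘(ℝ, E) (f x)} {U : Set M}
    {x : M} (hU : IsOpen U) (hx : x ∈ U) (hV : IsSmoothAlongOn (F := F) f V U) :
    ∃ W : ∀ x : M, TangentSpace 𝓘(ℝ, E) (f x), IsSmoothAlongOn (F := F) f W univ ∧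
      (∀ᶠ y in 𝓝 x, W y = V y) ∧ (∀ y, ∃ c : ℝ, W y = c • V y) ∧ ∀ y, y ∉ U → W y = 0 := by
  obtain ⟨b, -, hb⟩ := (SmoothBumpFunction.nhds_basis_tsupport (I := 𝓘(ℝ, F)) x).mem_iff.1
    (hU.mem_nhds hx)
  refine ⟨fun y => b y • V y, isSmoothAlongOn_of_forall fun y _ => ?_, ?_, fun y => ⟨b y, rfl⟩, ?_⟩
  · by_cases hy : y ∈ U
    · exact (hV.smoothAt hU hy).smul b.contMDiffAt
    -- Nothing is known about `V` at this point, but it lies off the closed support of the bump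
    -- function, so the product is zero on a whole neighbourhood.
    · refine (isSmoothAlongAt_zero (hf y)).congr ?_
      have : y ∉ tsupport b := fun h => hy (hb h)
      filter_upwards [(isClosed_tsupport b).isOpen_compl.mem_nhds this] with z hz
      rw [image_eq_zero_of_notMem_tsupport hz, zero_smul]
  · filter_upwards [b.eventuallyEq_one] with y hy
    simp [hy]
  · intro y hy
    have : y ∉ tsupport b := fun h => hy (hb h)
    simp [image_eq_zero_of_notMem_tsupport this]

/-! ## The Levi-Civita connection in coordinates -/

section Coordinates

variable {G : Type*} [NormedAddCommGroup G] [NormedSpace ℝ G]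

/-- The model has no boundary, so the derivative within its range is an ordinary derivative. This
moves every computation below to normed spaces. -/
theorem hasFDerivAt_comp_extChartAt_symm {v : M → G} {x : M}
    (h : MDifferentiableAt 𝓘(ℝ, F) 𝓘(ℝ, G) v x) :
    HasFDerivAt (v ∘ (extChartAt 𝓘(ℝ, F) x).symm)
      (mfderiv 𝓘(ℝ, F) 𝓘(ℝ, G) v x : F →L[ℝ] G) (extChartAt 𝓘(ℝ, F) x x) := by
  have := h.hasMFDerivAt.2
  rw [ModelWithCorners.range_eq_univ] at this
  exact hasFDerivWithinAt_univ.1 this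

theorem mfderiv_apply_of_hasFDerivAt {v : M → G} {x : M}
    (h : MDifferentiableAt 𝓘(ℝ, F) 𝓘(ℝ, G) v x) {L : F →L[ℝ] G}
    (hL : HasFDerivAt (v ∘ (extChartAt 𝓘(ℝ, F) x).symm) L (extChartAt 𝓘(ℝ, F) x x)) (w : F) :
    (mfderiv 𝓘(ℝ, F) 𝓘(ℝ, G) v x w : G) = L w := by
  have e := HasFDerivAt.unique (𝕜 := ℝ) (E := F) (F := G) (hasFDerivAt_comp_extChartAt_symm h) hL
  exact congrArg (fun L : F →L[ℝ] G => L w) e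

theorem hasFDerivAt_writtenInExtChartAt {f : M → N} {x : M}
    (h : MDifferentiableAt 𝓘(ℝ, F) 𝓘(ℝ, E) f x) :
    HasFDerivAt (extChartAt 𝓘(ℝ, E) (f x) ∘ f ∘ (extChartAt 𝓘(ℝ, F) x).symm)
      (mfderiv 𝓘(ℝ, F) 𝓘(ℝ, E) f x : F →L[ℝ] E) (extChartAt 𝓘(ℝ, F) x x) := by
  have := h.hasMFDerivAt.2
  rw [ModelWithCorners.range_eq_univ] at this
  exact hasFDerivWithinAt_univ.1 this

theorem mem_baseSet_iff {p y : N} :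
    y ∈ (trivializationAt E (TangentSpace 𝓘(ℝ, E)) p).baseSet ↔
      y ∈ (extChartAt 𝓘(ℝ, E) p).source := by
  rw [TangentBundle.trivializationAt_baseSet, extChartAt_source]

theorem symmL_trivialization_snd {p y : N}
    (hy : y ∈ (trivializationAt E (TangentSpace 𝓘(ℝ, E)) p).baseSet)
    (u : TangentSpace 𝓘(ℝ, E) y) :
    (trivializationAt E (TangentSpace 𝓘(ℝ, E)) p).symmL ℝ y
      (trivializationAt E (TangentSpace 𝓘(ℝ, E)) p ⟨y, u⟩).2 = u := by
  rw [Bundle.Trivialization.symmL_apply _ hy]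
  exact Bundle.Trivialization.symm_apply_apply_mk _ hy u

/-- The product rule for a bilinear form with moving base point; only the values of the derivative
are exposed. -/
theorem exists_hasFDerivAt_form {B : E → E →L[ℝ] E →L[ℝ] ℝ} {B' : E →L[ℝ] E →L[ℝ] E →L[ℝ] ℝ}
    {φ v w : F → E} {φ' v' w' : F →L[ℝ] E} {z : F} (hB : HasFDerivAt B B' (φ z))
    (hφ : HasFDerivAt φ φ' z) (hv : HasFDerivAt v v' z) (hw : HasFDerivAt w w' z) :
    ∃ L : F →L[ℝ] ℝ, HasFDerivAt (fun y => B (φ y) (v y) (w y)) L z ∧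
      ∀ a, L a = B' (φ' a) (v z) (w z) + B (φ z) (v' a) (w z) + B (φ z) (v z) (w' a) :=
  ⟨_, ((hB.comp z hφ).clm_apply hv).clm_apply hw, fun a => by simp; ring⟩

theorem exists_hasFDerivAt_apply {G₁ G₂ : Type*} [NormedAddCommGroup G₁] [NormedSpace ℝ G₁]
    [NormedAddCommGroup G₂] [NormedSpace ℝ G₂] {A : G₁ → G →L[ℝ] G₂} {A' : G₁ →L[ℝ] G →L[ℝ] G₂}
    {φ : F → G₁} {v : F → G} {φ' : F →L[ℝ] G₁} {v' : F →L[ℝ] G} {z : F}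
    (hA : HasFDerivAt A A' (φ z)) (hφ : HasFDerivAt φ φ' z) (hv : HasFDerivAt v v' z) :
    ∃ L : F →L[ℝ] G₂, HasFDerivAt (fun y => A (φ y) (v y)) L z ∧
      ∀ a, L a = A' (φ' a) (v z) + A (φ z) (v' a) :=
  ⟨_, (hA.comp z hφ).clm_apply hv, fun a => by simp; abel⟩

/-- In finite dimension, smoothness in operator norm can be tested on each vector separately. -/
theorem contDiffAt_of_forall_apply [FiniteDimensional ℝ E] {H : E → E →L[ℝ] G} {z : E}
    (U : Set E) (hU : IsOpen U) (hz : z ∈ U) (h : ∀ u, ContDiffOn ℝ ∞ (fun y => H y u) U) :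
    ContDiffAt ℝ ∞ H z :=
  (contDiffOn_clm_apply.2 h).contDiffAt (hU.mem_nhds hz)

end Coordinates

/-- The derivative at `x` of the coordinates of a vector field along `f` in the chart at `f x`. -/
def alongDeriv (f : M → N) (V : ∀ x : M, TangentSpace 𝓘(ℝ, E) (f x)) (x : M)
    (w : TangentSpace 𝓘(ℝ, F) x) : TangentSpace 𝓘(ℝ, E) (f x) :=
  (mfderiv 𝓘(ℝ, F) 𝓘(ℝ, E) (alongCoord f V x) x w : E)

namespace SemiRiemannianMetric

variable (g : SemiRiemannianMetric E N)

theorem chartForm_apply (p : N) (z u v : E) : g.chartForm p z u v =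
    g.val ((extChartAt 𝓘(ℝ, E) p).symm z)
      ((trivializationAt E (TangentSpace 𝓘(ℝ, E)) p).symmL ℝ ((extChartAt 𝓘(ℝ, E) p).symm z) u)
      ((trivializationAt E (TangentSpace 𝓘(ℝ, E)) p).symmL ℝ ((extChartAt 𝓘(ℝ, E) p).symm z) v) :=
  rfl

theorem chartForm_apply_coord {p y : N}
    (hy : y ∈ (trivializationAt E (TangentSpace 𝓘(ℝ, E)) p).baseSet)
    (u v : TangentSpace 𝓘(ℝ, E) y) :
    g.chartForm p (extChartAt 𝓘(ℝ, E) p y)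
      (trivializationAt E (TangentSpace 𝓘(ℝ, E)) p ⟨y, u⟩).2
      (trivializationAt E (TangentSpace 𝓘(ℝ, E)) p ⟨y, v⟩).2 = g.val y u v := by
  -- The chart followed by its inverse returns `y` only up to a propositional equality on which the
  -- fibre depends; a free base point `z` lets it be substituted.
  have key : ∀ z : N, z = y →
      g.val z ((trivializationAt E (TangentSpace 𝓘(ℝ, E)) p).symmL ℝ z
        (trivializationAt E (TangentSpace 𝓘(ℝ, E)) p ⟨y, u⟩).2)
        ((trivializationAt E (TangentSpace 𝓘(ℝ, E)) p).symmL ℝ z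
        (trivializationAt E (TangentSpace 𝓘(ℝ, E)) p ⟨y, v⟩).2) = g.val y u v := by
    rintro z rfl
    rw [symmL_trivialization_snd hy, symmL_trivialization_snd hy]
  exact key _ ((extChartAt 𝓘(ℝ, E) p).left_inv (mem_baseSet_iff.1 hy))

theorem chartForm_self (p : N) (u v : TangentSpace 𝓘(ℝ, E) p) :
    g.chartForm p (extChartAt 𝓘(ℝ, E) p p) u v = g.val p u v := by
  have := g.chartForm_apply_coord (FiberBundle.mem_baseSet_trivializationAt' p) u v
  rwa [trivializationAt_tangent_self, trivializationAt_tangent_self] at this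

theorem chartForm_symm (p : N) (z u v : E) : g.chartForm p z u v = g.chartForm p z v u := by
  rw [chartForm_apply, chartForm_apply, g.symm]

/-- The matrix entries are the metric evaluated on two constant coordinate fields, which are smooth
on the chart domain. -/
theorem contDiffAt_chartForm [FiniteDimensional ℝ E] (p : N) :
    ContDiffAt ℝ ∞ (g.chartForm p) (extChartAt 𝓘(ℝ, E) p p) := by
  refine contDiffAt_of_forall_apply _ (isOpen_extChartAt_target p) (mem_extChartAt_target p)
    fun u => contDiffOn_clm_apply.2 fun v => ?_
  intro z hz
  have hy := (extChartAt 𝓘(ℝ, E) p).map_target hz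
  have h1 := mem_baseSet_iff.2 hy
  have h2 := ((isSmoothAlongAt_constField u h1).metric g (isSmoothAlongAt_constField v h1))
  refine (h2.comp_contMDiffWithinAt z
    ((contMDiffOn_extChartAt_symm p) z hz)).contDiffWithinAt.congr (fun y hy => ?_) ?_
  · rw [chartForm_apply, Bundle.Trivialization.symmL_apply _
      (mem_baseSet_iff.2 ((extChartAt 𝓘(ℝ, E) p).map_target hy)),
      Bundle.Trivialization.symmL_apply _
        (mem_baseSet_iff.2 ((extChartAt 𝓘(ℝ, E) p).map_target hy))]
    rfl
  · rw [chartForm_apply, Bundle.Trivialization.symmL_apply _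
      (mem_baseSet_iff.2 ((extChartAt 𝓘(ℝ, E) p).map_target hz)),
      Bundle.Trivialization.symmL_apply _
        (mem_baseSet_iff.2 ((extChartAt 𝓘(ℝ, E) p).map_target hz))]
    rfl

theorem chartFormDeriv_symm [FiniteDimensional ℝ E] (p : N) (w u v : E) :
    g.chartFormDeriv p w u v = g.chartFormDeriv p w v u := by
  have hd := ((g.contDiffAt_chartForm p).differentiableAt (by simp)).hasFDerivAt
  have h : ∀ a b : E, HasFDerivAt (fun z => g.chartForm p z a b)
      (((g.chartFormDeriv p).flip a).flip b) (extChartAt 𝓘(ℝ, E) p p) := fun a b => by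
    have := (hd.clm_apply (hasFDerivAt_const a _)).clm_apply (hasFDerivAt_const b _)
    refine this.congr_fderiv ?_
    ext w
    simp [chartFormDeriv]
  have h1 := h u v
  simp only [g.chartForm_symm p _ u v] at h1
  exact congrArg (fun L : E →L[ℝ] ℝ => L w) (h1.unique (h v u))

variable [FiniteDimensional ℝ E]

theorem christoffelFirst_symm (p : N) (u v : E) :
    g.christoffelFirst p u v = g.christoffelFirst p v u := by
  ext w
  rw [christoffelFirst_apply, christoffelFirst_apply, g.chartFormDeriv_symm p w u v]
  ring

/-- The derivatives in the directions `u` and `v` cancel. This is metric compatibility in a chart.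
-/
theorem christoffelFirst_add (p : N) (w u v : E) :
    g.christoffelFirst p w u v + g.christoffelFirst p w v u = g.chartFormDeriv p w u v := by
  rw [christoffelFirst_apply, christoffelFirst_apply, g.chartFormDeriv_symm p u w v,
    g.chartFormDeriv_symm p v w u, g.chartFormDeriv_symm p w v u]
  ring

/-- Absence of torsion, in a chart. -/
theorem christoffel_symm (p : N) (u v : TangentSpace 𝓘(ℝ, E) p) :
    g.christoffel p u v = g.christoffel p v u :=
  congrArg (fun L : E →L[ℝ] ℝ => ((g.bilin p).toDual (g.bilin_nondegenerate p)).symm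
    (show TangentSpace 𝓘(ℝ, E) p →ₗ[ℝ] ℝ from (L : E →ₗ[ℝ] ℝ))) (g.christoffelFirst_symm p u v)

theorem chartFormDeriv_eq (p : N) (w u v : TangentSpace 𝓘(ℝ, E) p) :
    g.chartFormDeriv p w u v =
      g.val p (g.christoffel p w u) v + g.val p u (g.christoffel p w v) := by
  rw [g.symm p u, christoffel_spec, christoffel_spec]
  exact (g.christoffelFirst_add p w u v).symm

theorem nablaAlong_eq (f : M → N) (V : ∀ x : M, TangentSpace 𝓘(ℝ, E) (f x)) (x : M)
    (w : TangentSpace 𝓘(ℝ, F) x) :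
    g.nablaAlong f V x w = alongDeriv f V x w +
      g.christoffel (f x) (mfderiv 𝓘(ℝ, F) 𝓘(ℝ, E) f x w) (V x) := rfl

/-- The Levi-Civita connection is metric. -/
theorem mfderiv_metric {f : M → N} {V W : ∀ x : M, TangentSpace 𝓘(ℝ, E) (f x)} {x : M}
    (hV : IsSmoothAlongAt (F := F) f V x) (hW : IsSmoothAlongAt (F := F) f W x)
    (w : TangentSpace 𝓘(ℝ, F) x) :
    (mfderiv 𝓘(ℝ, F) 𝓘(ℝ, ℝ) (fun y => g.val (f y) (V y) (W y)) x w : ℝ) =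
      g.val (f x) (g.nablaAlong f V x w) (W x) + g.val (f x) (V x) (g.nablaAlong f W x w) := by
  have hl : (extChartAt 𝓘(ℝ, F) x).symm (extChartAt 𝓘(ℝ, F) x x) = x := extChartAt_to_inv x
  have hf := hasFDerivAt_writtenInExtChartAt (hV.map.mdifferentiableAt (by simp))
  have hv := hasFDerivAt_comp_extChartAt_symm (hV.coord.mdifferentiableAt (by simp))
  have hw := hasFDerivAt_comp_extChartAt_symm (hW.coord.mdifferentiableAt (by simp))
  have hG : HasFDerivAt (g.chartForm (f x)) (g.chartFormDeriv (f x))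
      ((extChartAt 𝓘(ℝ, E) (f x) ∘ f ∘ (extChartAt 𝓘(ℝ, F) x).symm)
        (extChartAt 𝓘(ℝ, F) x x)) := by
    simp only [Function.comp_apply, hl]
    exact ((g.contDiffAt_chartForm (f x)).differentiableAt (by simp)).hasFDerivAt
  obtain ⟨L, hL, hLa⟩ := exists_hasFDerivAt_form hG hf hv hw
  -- The coordinate expression is valid only while `f` stays in the chart at `f x`, hence a germ
  -- equality, which suffices for derivatives.
  have he : (fun y => g.val (f y) (V y) (W y)) ∘ (extChartAt 𝓘(ℝ, F) x).symm
      =ᶠ[𝓝 (extChartAt 𝓘(ℝ, F) x x)] fun z =>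
        g.chartForm (f x) ((extChartAt 𝓘(ℝ, E) (f x) ∘ f ∘ (extChartAt 𝓘(ℝ, F) x).symm) z)
          ((alongCoord f V x ∘ (extChartAt 𝓘(ℝ, F) x).symm) z)
          ((alongCoord f W x ∘ (extChartAt 𝓘(ℝ, F) x).symm) z) := by
    have hcont : ContinuousAt (extChartAt 𝓘(ℝ, F) x).symm (extChartAt 𝓘(ℝ, F) x x) :=
      continuousAt_extChartAt_symm x
    have := eventually_mem_baseSet (E := E) hV.map.continuousAt
    rw [← hl] at this
    filter_upwards [hcont.eventually this] with z hz
    rw [hl] at hz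
    exact (g.chartForm_apply_coord hz _ _).symm
  have hu := mfderiv_apply_of_hasFDerivAt ((hV.metric g hW).mdifferentiableAt (by simp))
    (hL.congr_of_eventuallyEq he) w
  refine (hu.trans (hLa w)).trans ?_
  simp only [Function.comp_apply, hl]
  rw [alongCoord_self, alongCoord_self, nablaAlong_eq, nablaAlong_eq, map_add, map_add,
    add_apply]
  -- The derivative of the metric supplies both Christoffel terms; the derivatives of `V` and `W`
  -- supply the rest.
  refine (congrArg₂ (· + ·) (congrArg₂ (· + ·) (g.chartFormDeriv_eq (f x) _ _ _)
    (g.chartForm_self _ _ _)) (g.chartForm_self _ _ _)).trans ?_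
  exact (by intros; ring : ∀ a b c d : ℝ, a + b + c + d = c + a + (d + b)) _ _ _ _

end SemiRiemannianMetric

/-! ## Parallel endomorphisms along a map -/

namespace MetallicStructure

variable {p q : ℕ} (J : MetallicStructure E N p q)

/-- The matrix of `J` in the chart at `a`, as a function of the coordinates. -/
def chartEnd (a : N) (z : E) : E →L[ℝ] E :=
  let y : N := (extChartAt 𝓘(ℝ, E) a).symm z
  let A : E →L[ℝ] E := (trivializationAt E (TangentSpace 𝓘(ℝ, E)) a).symmL ℝ y
  let B : E →L[ℝ] E := (trivializationAt E (TangentSpace 𝓘(ℝ, E)) a).continuousLinearMapAt ℝ y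
  let C : E →L[ℝ] E := J.val y
  B ∘L C ∘L A

theorem chartEnd_apply (a : N) (z u : E) : J.chartEnd a z u =
    (trivializationAt E (TangentSpace 𝓘(ℝ, E)) a).continuousLinearMapAt ℝ
      ((extChartAt 𝓘(ℝ, E) a).symm z) (J.val ((extChartAt 𝓘(ℝ, E) a).symm z)
      ((trivializationAt E (TangentSpace 𝓘(ℝ, E)) a).symmL ℝ
        ((extChartAt 𝓘(ℝ, E) a).symm z) u)) :=
  rfl

theorem chartEnd_apply_of_mem (a : N) {z : E} (hz : z ∈ (extChartAt 𝓘(ℝ, E) a).target) (u : E) :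
    J.chartEnd a z u = (trivializationAt E (TangentSpace 𝓘(ℝ, E)) a
      ⟨(extChartAt 𝓘(ℝ, E) a).symm z, J.val ((extChartAt 𝓘(ℝ, E) a).symm z)
        (constField a u ((extChartAt 𝓘(ℝ, E) a).symm z))⟩).2 := by
  have h := mem_baseSet_iff.2 ((extChartAt 𝓘(ℝ, E) a).map_target hz)
  rw [chartEnd_apply, Bundle.Trivialization.symmL_apply _ h,
    Bundle.Trivialization.continuousLinearMapAt_apply,
    Bundle.Trivialization.coe_linearMapAt_of_mem _ h]
  rfl

theorem chartEnd_apply_coord {a y : N}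
    (hy : y ∈ (trivializationAt E (TangentSpace 𝓘(ℝ, E)) a).baseSet)
    (u : TangentSpace 𝓘(ℝ, E) y) :
    J.chartEnd a (extChartAt 𝓘(ℝ, E) a y)
      (trivializationAt E (TangentSpace 𝓘(ℝ, E)) a ⟨y, u⟩).2 =
      (trivializationAt E (TangentSpace 𝓘(ℝ, E)) a ⟨y, J.val y u⟩).2 := by
  have hs := mem_baseSet_iff.1 hy
  rw [chartEnd_apply_of_mem _ _ ((extChartAt 𝓘(ℝ, E) a).map_source hs)]
  have key : ∀ z : N, z = y →
      (trivializationAt E (TangentSpace 𝓘(ℝ, E)) a ⟨z, J.val z (constField a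
        (trivializationAt E (TangentSpace 𝓘(ℝ, E)) a ⟨y, u⟩).2 z)⟩).2 =
      (trivializationAt E (TangentSpace 𝓘(ℝ, E)) a ⟨y, J.val y u⟩).2 := by
    rintro z rfl
    rw [constField, Bundle.Trivialization.symm_apply_apply_mk _ hy u]
  exact key _ ((extChartAt 𝓘(ℝ, E) a).left_inv hs)

theorem chartEnd_self (a : N) (u : TangentSpace 𝓘(ℝ, E) a) :
    J.chartEnd a (extChartAt 𝓘(ℝ, E) a a) u = J.val a u := by
  have := J.chartEnd_apply_coord (FiberBundle.mem_baseSet_trivializationAt' a) u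
  rwa [trivializationAt_tangent_self, trivializationAt_tangent_self] at this

theorem contDiffAt_chartEnd [FiniteDimensional ℝ E] (a : N) :
    ContDiffAt ℝ ∞ (J.chartEnd a) (extChartAt 𝓘(ℝ, E) a a) := by
  refine contDiffAt_of_forall_apply _ (isOpen_extChartAt_target a) (mem_extChartAt_target a)
    fun u z hz => ?_
  have h1 := mem_baseSet_iff.2 ((extChartAt 𝓘(ℝ, E) a).map_target hz)
  have h2 := (((trivializationAt E (TangentSpace 𝓘(ℝ, E)) a).contMDiffAt_iff (IB := 𝓘(ℝ, E))
    ((Bundle.Trivialization.mem_source _).2 h1)).1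
    ((isSmoothAlongAt_constField u h1).metallic J)).2
  exact (h2.comp_contMDiffWithinAt z
    ((contMDiffOn_extChartAt_symm a) z hz)).contDiffWithinAt.congr
    (fun y hy => J.chartEnd_apply_of_mem a hy u) (J.chartEnd_apply_of_mem a hz u)

/-- The derivative at `a` of the matrix of `J` in the chart at `a`. -/
def chartEndDeriv (a : N) (w u : TangentSpace 𝓘(ℝ, E) a) : TangentSpace 𝓘(ℝ, E) a :=
  let A : E →L[ℝ] E →L[ℝ] E := fderiv ℝ (J.chartEnd a) (extChartAt 𝓘(ℝ, E) a a)
  A w u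

variable {g : SemiRiemannianMetric E N} [FiniteDimensional ℝ E]

theorem alongCoord_metallic {f : M → N} (V : ∀ x : M, TangentSpace 𝓘(ℝ, E) (f x)) {x y : M}
    (hy : f y ∈ (trivializationAt E (TangentSpace 𝓘(ℝ, E)) (f x)).baseSet) :
    alongCoord f (fun y => J.val (f y) (V y)) x y =
      J.chartEnd (f x) (extChartAt 𝓘(ℝ, E) (f x) (f y)) (alongCoord f V x y) :=
  (J.chartEnd_apply_coord hy (V y)).symm

/-- The product rule for the matrix of `J` along `f` applied to the coordinates of `V`. -/
theorem alongDeriv_metallic {f : M → N} {V : ∀ x : M, TangentSpace 𝓘(ℝ, E) (f x)} {x : M}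
    (hV : IsSmoothAlongAt (F := F) f V x) (w : TangentSpace 𝓘(ℝ, F) x) :
    alongDeriv f (fun y => J.val (f y) (V y)) x w =
      J.chartEndDeriv (f x) (mfderiv 𝓘(ℝ, F) 𝓘(ℝ, E) f x w) (V x) +
        J.val (f x) (alongDeriv f V x w) := by
  have hl : (extChartAt 𝓘(ℝ, F) x).symm (extChartAt 𝓘(ℝ, F) x x) = x := extChartAt_to_inv x
  have hf := hasFDerivAt_writtenInExtChartAt (hV.map.mdifferentiableAt (by simp))
  have hv := hasFDerivAt_comp_extChartAt_symm (hV.coord.mdifferentiableAt (by simp))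
  have hA : HasFDerivAt (J.chartEnd (f x))
      (fderiv ℝ (J.chartEnd (f x)) (extChartAt 𝓘(ℝ, E) (f x) (f x)))
      ((extChartAt 𝓘(ℝ, E) (f x) ∘ f ∘ (extChartAt 𝓘(ℝ, F) x).symm)
        (extChartAt 𝓘(ℝ, F) x x)) := by
    simp only [Function.comp_apply, hl]
    exact ((J.contDiffAt_chartEnd (f x)).differentiableAt (by simp)).hasFDerivAt
  obtain ⟨L, hL, hLa⟩ := exists_hasFDerivAt_apply hA hf hv
  have he : alongCoord f (fun y => J.val (f y) (V y)) x ∘ (extChartAt 𝓘(ℝ, F) x).symm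
      =ᶠ[𝓝 (extChartAt 𝓘(ℝ, F) x x)] fun z =>
        J.chartEnd (f x) ((extChartAt 𝓘(ℝ, E) (f x) ∘ f ∘ (extChartAt 𝓘(ℝ, F) x).symm) z)
          ((alongCoord f V x ∘ (extChartAt 𝓘(ℝ, F) x).symm) z) := by
    have hcont : ContinuousAt (extChartAt 𝓘(ℝ, F) x).symm (extChartAt 𝓘(ℝ, F) x x) :=
      continuousAt_extChartAt_symm x
    have := eventually_mem_baseSet (E := E) hV.map.continuousAt
    rw [← hl] at this
    filter_upwards [hcont.eventually this] with z hz
    rw [hl] at hz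
    exact J.alongCoord_metallic V hz
  have hu := mfderiv_apply_of_hasFDerivAt ((hV.metallic J).coord.mdifferentiableAt (by simp))
    (hL.congr_of_eventuallyEq he) w
  refine (hu.trans (hLa w)).trans ?_
  simp only [Function.comp_apply, hl]
  exact congrArg₂ (· + ·) (congrArg (fderiv ℝ (J.chartEnd (f x)) _ _) (alongCoord_self f V x)) (J.chartEnd_self _ _)

variable {J} in
-- Parallelism is assumed only for global fields on `N`. Testing it on fields with constant
-- coordinates near `a`, cut off by a bump function, gives a pointwise identity that can be used
-- along any map.
theorem IsParallel.christoffel [T2Space N] (hJ : J.IsParallel g) (a : N)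
    (w u : TangentSpace 𝓘(ℝ, E) a) :
    J.chartEndDeriv a w u + g.christoffel a w (J.val a u) = J.val a (g.christoffel a w u) := by
  have hs : ∀ v : E, ∃ V : ∀ y : N, TangentSpace 𝓘(ℝ, E) y, IsVectorField V ∧
      ∀ᶠ y in 𝓝 a, V y = constField a v y := fun v => by
    have ho := (trivializationAt E (TangentSpace 𝓘(ℝ, E)) a).open_baseSet
    obtain ⟨V, h1, h2, -⟩ := exists_global_extension (f := fun y : N => y) contMDiff_id ho
      (FiberBundle.mem_baseSet_trivializationAt' a)
      (isSmoothAlongOn_of_forall fun y hy => isSmoothAlongAt_constField v hy)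
    exact ⟨V, contMDiffOn_univ.1 h1, h2⟩
  obtain ⟨W, hW, hWa⟩ := hs w
  obtain ⟨U, hU, hUa⟩ := hs u
  have hW1 : W a = w := hWa.self_of_nhds.trans (constField_self (E := E) a w)
  have hU1 : U a = u := hUa.self_of_nhds.trans (constField_self (E := E) a u)
  have hUs : IsSmoothAlongAt (F := E) (fun y : N => y) U a := hU a
  have h := hJ W U hW hU a
  -- Constant coordinates near `a` leave only the Christoffel term in `∇U`.
  have hc : alongDeriv (F := E) (fun y : N => y) U a (W a) = 0 := by
    have he : alongCoord (fun y : N => y) U a =ᶠ[𝓝 a] fun _ => show E from u := by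
      filter_upwards [hUa, (trivializationAt E (TangentSpace 𝓘(ℝ, E)) a).open_baseSet.mem_nhds
        (FiberBundle.mem_baseSet_trivializationAt' a)] with y hy hb
      refine Eq.trans ?_ (alongCoord_constField (E := E) u hb)
      rw [alongCoord, hy]
      rfl
    rw [alongDeriv, he.mfderiv_eq, mfderiv_const]
    rfl
  have hi : mfderiv 𝓘(ℝ, E) 𝓘(ℝ, E) (fun y : N => y) a (W a) = w := by
    rw [hW1]
    exact congrArg (fun L : E →L[ℝ] E => L w) (mfderiv_id (I := 𝓘(ℝ, E)) (x := a))
  rw [g.nablaAlong_eq, g.nablaAlong_eq, J.alongDeriv_metallic hUs, hc, hi, hU1, map_zero,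
    add_zero, zero_add] at h
  exact h

/-- A parallel `J` commutes with the covariant derivative along any map. -/
theorem IsParallel.nablaAlong [T2Space N] {J : MetallicStructure E N p q} (hJ : J.IsParallel g)
    {f : M → N} {V : ∀ x : M, TangentSpace 𝓘(ℝ, E) (f x)} {x : M}
    (hV : IsSmoothAlongAt (F := F) f V x) (w : TangentSpace 𝓘(ℝ, F) x) :
    g.nablaAlong f (fun y => J.val (f y) (V y)) x w = J.val (f x) (g.nablaAlong f V x w) := by
  rw [g.nablaAlong_eq f V, map_add, ← hJ.christoffel, g.nablaAlong_eq, J.alongDeriv_metallic hV]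
  abel

end MetallicStructure

/-! ## The second fundamental form in coordinates -/

theorem trivialization_snd_eq_mfderiv {a y : N}
    (hy : y ∈ (trivializationAt E (TangentSpace 𝓘(ℝ, E)) a).baseSet)
    (u : TangentSpace 𝓘(ℝ, E) y) :
    (trivializationAt E (TangentSpace 𝓘(ℝ, E)) a ⟨y, u⟩).2 =
      mfderiv 𝓘(ℝ, E) 𝓘(ℝ, E) (extChartAt 𝓘(ℝ, E) a) y u := by
  have h : (trivializationAt E (TangentSpace 𝓘(ℝ, E)) a).continuousLinearMapAt ℝ y u =
      (trivializationAt E (TangentSpace 𝓘(ℝ, E)) a ⟨y, u⟩).2 := by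
    rw [Bundle.Trivialization.continuousLinearMapAt_apply,
      Bundle.Trivialization.coe_linearMapAt_of_mem _ hy]
  rw [TangentBundle.trivializationAt_baseSet] at hy
  exact h.symm.trans (congrArg (fun L : E →L[ℝ] E => L u)
    (TangentBundle.continuousLinearMapAt_trivializationAt (I := 𝓘(ℝ, E)) hy))

theorem contDiffAt_writtenInExtChartAt {f : M → N} (hf : ContMDiff 𝓘(ℝ, F) 𝓘(ℝ, E) ∞ f)
    (x : M) :
    ContDiffAt ℝ ∞ (extChartAt 𝓘(ℝ, E) (f x) ∘ f ∘ (extChartAt 𝓘(ℝ, F) x).symm)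
      (extChartAt 𝓘(ℝ, F) x x) := by
  have := (contMDiffAt_iff.1 (hf x)).2
  rw [ModelWithCorners.range_eq_univ] at this
  exact contDiffWithinAt_univ.1 this

/-- The trivializations are the differentials of the charts, so this is the chain rule. It is needed
on a neighbourhood because it is differentiated once more. -/
theorem eventually_alongCoord_push {f : M → N} (hf : ContMDiff 𝓘(ℝ, F) 𝓘(ℝ, E) ∞ f)
    (x : M) : ∀ᶠ y in 𝓝 x, ∀ u : TangentSpace 𝓘(ℝ, F) y,
    (trivializationAt E (TangentSpace 𝓘(ℝ, E)) (f x)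
      ⟨f y, mfderiv 𝓘(ℝ, F) 𝓘(ℝ, E) f y u⟩).2 =
    fderiv ℝ (extChartAt 𝓘(ℝ, E) (f x) ∘ f ∘ (extChartAt 𝓘(ℝ, F) x).symm)
      (extChartAt 𝓘(ℝ, F) x y) (trivializationAt F (TangentSpace 𝓘(ℝ, F)) x ⟨y, u⟩).2 := by
  have h1 := eventually_mem_baseSet (E := E) (hf x).continuousAt
  have h2 := eventually_mem_baseSet (E := F) (continuousAt_id (x := x))
  -- Smoothness of finite order at a point persists nearby, so the order is lowered to `1`.
  have h3 := (((contDiffAt_writtenInExtChartAt hf x).of_le (m := 1) (by simp)).eventually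
    (by simp))
  have h4 := (continuousAt_extChartAt (I := 𝓘(ℝ, F)) x).eventually h3
  filter_upwards [h1, h2, h4] with y hy1 hy2 hy4 u
  have hy2' : y ∈ (trivializationAt F (TangentSpace 𝓘(ℝ, F)) x).baseSet := hy2
  rw [trivialization_snd_eq_mfderiv hy1, trivialization_snd_eq_mfderiv hy2']
  set φ := extChartAt 𝓘(ℝ, E) (f x) ∘ f ∘ (extChartAt 𝓘(ℝ, F) x).symm with hφ
  have e1 : MDifferentiableAt 𝓘(ℝ, E) 𝓘(ℝ, E) (extChartAt 𝓘(ℝ, E) (f x)) (f y) :=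
    mdifferentiableAt_extChartAt (by rwa [TangentBundle.trivializationAt_baseSet] at hy1)
  have e2 : MDifferentiableAt 𝓘(ℝ, F) 𝓘(ℝ, F) (extChartAt 𝓘(ℝ, F) x) y :=
    mdifferentiableAt_extChartAt (by rwa [TangentBundle.trivializationAt_baseSet] at hy2')
  have e3 : MDifferentiableAt 𝓘(ℝ, F) 𝓘(ℝ, E) φ (extChartAt 𝓘(ℝ, F) x y) :=
    (hy4.differentiableAt (by simp)).mdifferentiableAt
  have e4 : extChartAt 𝓘(ℝ, E) (f x) ∘ f =ᶠ[𝓝 y] φ ∘ extChartAt 𝓘(ℝ, F) x := by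
    filter_upwards [(trivializationAt F (TangentSpace 𝓘(ℝ, F)) x).open_baseSet.mem_nhds hy2']
      with z hz
    simp only [hφ, Function.comp_apply, (extChartAt 𝓘(ℝ, F) x).left_inv (mem_baseSet_iff.1 hz)]
  have e5 := mfderiv_comp y e1 ((hf y).mdifferentiableAt (by simp))
  have e6 := mfderiv_comp y e3 e2
  have e7 := e4.mfderiv_eq (I := 𝓘(ℝ, F)) (I' := 𝓘(ℝ, E))
  have e8 := e5.symm.trans (e7.trans e6)
  rw [mfderiv_eq_fderiv] at e8
  exact congrArg (fun L : F →L[ℝ] E => L u) e8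

/-- The covariant derivative along an immersion of a tangent vector field is, up to a tangent
vector, symmetric in the two arguments. -/
theorem exists_symm_nablaAlong_push {f : M → N} (hf : ContMDiff 𝓘(ℝ, F) 𝓘(ℝ, E) ∞ f)
    (g : SemiRiemannianMetric E N) [FiniteDimensional ℝ E]
    (x : M) : ∃ H : TangentSpace 𝓘(ℝ, F) x → TangentSpace 𝓘(ℝ, F) x →
      TangentSpace 𝓘(ℝ, E) (f x), (∀ u v, H u v = H v u) ∧
      ∀ U : (∀ y : M, TangentSpace 𝓘(ℝ, F) y), IsVectorField U → ∀ w,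
        ∃ t ∈ tangentAlong (F := F) f x,
          g.nablaAlong f (fun y => mfderiv 𝓘(ℝ, F) 𝓘(ℝ, E) f y (U y)) x w = t + H w (U x) := by
  have hφ := contDiffAt_writtenInExtChartAt hf x
  set φ := extChartAt 𝓘(ℝ, E) (f x) ∘ f ∘ (extChartAt 𝓘(ℝ, F) x).symm
  have hl : (extChartAt 𝓘(ℝ, F) x).symm (extChartAt 𝓘(ℝ, F) x x) = x := extChartAt_to_inv x
  let H₀ : F → F → E := fun u v => fderiv ℝ (fderiv ℝ φ) (extChartAt 𝓘(ℝ, F) x x) u v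
  have hs : ∀ u v, H₀ u v = H₀ v u := fun u v =>
    (hφ.isSymmSndFDerivAt (by
      simpa using! WithTop.coe_le_coe.2 (le_top : (2 : ℕ∞) ≤ ⊤))) u v
  let H₁ : TangentSpace 𝓘(ℝ, F) x → TangentSpace 𝓘(ℝ, F) x →
      TangentSpace 𝓘(ℝ, E) (f x) := H₀
  -- `H(u, v) = D²φ(u, v) + Γ(df u, df v)`: both terms are symmetric, and no derivative of `U`
  -- enters.
  refine ⟨fun u v => H₁ u v + g.christoffel (f x) (mfderiv 𝓘(ℝ, F) 𝓘(ℝ, E) f x u)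
    (mfderiv 𝓘(ℝ, F) 𝓘(ℝ, E) f x v), fun u v => ?_, fun U hU w => ?_⟩
  · change H₁ u v + g.christoffel _ _ _ = H₁ v u + g.christoffel _ _ _
    rw [g.christoffel_symm, show H₁ u v = H₁ v u from hs u v]
  have hUs : IsSmoothAlongAt (F := F) (fun y : M => y) U x := hU x
  have hU' := hasFDerivAt_comp_extChartAt_symm (hUs.coord.mdifferentiableAt (by simp))
  have hA : HasFDerivAt (fderiv ℝ φ) (fderiv ℝ (fderiv ℝ φ) (extChartAt 𝓘(ℝ, F) x x))
      (id (extChartAt 𝓘(ℝ, F) x x)) :=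
    ((hφ.fderiv_right (m := 1)
      (WithTop.coe_le_coe.2 (le_top : (1 + 1 : ℕ∞) ≤ ⊤))).differentiableAt (by simp)).hasFDerivAt
  obtain ⟨L, hL, hLa⟩ := exists_hasFDerivAt_apply hA (hasFDerivAt_id _) hU'
  have he : alongCoord f (fun y => mfderiv 𝓘(ℝ, F) 𝓘(ℝ, E) f y (U y)) x ∘
      (extChartAt 𝓘(ℝ, F) x).symm =ᶠ[𝓝 (extChartAt 𝓘(ℝ, F) x x)] fun z =>
        fderiv ℝ φ (id z) ((alongCoord (fun y : M => y) U x ∘ (extChartAt 𝓘(ℝ, F) x).symm) z) := by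
    have hcont : ContinuousAt (extChartAt 𝓘(ℝ, F) x).symm (extChartAt 𝓘(ℝ, F) x x) :=
      continuousAt_extChartAt_symm x
    have := eventually_alongCoord_push hf x
    rw [← hl] at this
    filter_upwards [hcont.eventually this, extChartAt_target_mem_nhds x] with z hz hz2
    rw [hl] at hz
    refine (hz _).trans ?_
    rw [(extChartAt 𝓘(ℝ, F) x).right_inv hz2]
    rfl
  have hu := mfderiv_apply_of_hasFDerivAt
    ((isSmoothAlongAt_push hf hUs).coord.mdifferentiableAt (by simp))
    (hL.congr_of_eventuallyEq he) w
  -- In the product rule for `Dφ(U)`, the term differentiating `U` is the tangent one.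
  refine ⟨mfderiv 𝓘(ℝ, F) 𝓘(ℝ, E) f x (alongDeriv (F := F) (fun y : M => y) U x w), ⟨_, rfl⟩, ?_⟩
  rw [g.nablaAlong_eq, ← add_assoc]
  congr 1
  refine (hu.trans (hLa w)).trans ((add_comm _ _).trans (congrArg₂ (· + ·) ?_ ?_))
  · have := HasFDerivAt.fderiv (𝕜 := ℝ) (E := F) (F := E)
      (hasFDerivAt_writtenInExtChartAt ((hf x).mdifferentiableAt (by simp)))
    exact congrArg (fun L : F →L[ℝ] E => L (alongDeriv (F := F) (fun y : M => y) U x w)) this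
  · simp only [Function.comp_apply, hl]
    exact congrArg (H₀ w) (alongCoord_self (fun y : M => y) U x)

/-! ## Existence of sections -/

section Sections

variable [FiniteDimensional ℝ F] [T2Space M] {f : M → N}
  {P : ∀ x : M, Submodule ℝ (TangentSpace 𝓘(ℝ, E) (f x))} {x : M}

/-- A cutoff multiplies by scalars and so stays in the subspaces. Since the conditions quantify over
global sections, this is what makes them pointwise. -/
theorem exists_section_of_local (hf : ContMDiff 𝓘(ℝ, F) 𝓘(ℝ, E) ∞ f) {U : Set M} (hU : IsOpen U)
    (hx : x ∈ U) {V : ∀ x : M, TangentSpace 𝓘(ℝ, E) (f x)} (hV : IsSmoothAlongOn (F := F) f V U)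
    (hP : ∀ y ∈ U, V y ∈ P y) :
    ∃ W : ∀ x : M, TangentSpace 𝓘(ℝ, E) (f x), IsSectionOf (F := F) f P W ∧ W x = V x := by
  obtain ⟨W, h1, h2, h3, h4⟩ := exists_global_extension hf hU hx hV
  refine ⟨W, ⟨h1, fun y => ?_⟩, h2.self_of_nhds⟩
  by_cases hy : y ∈ U
  · obtain ⟨c, hc⟩ := h3 y
    rw [hc]
    exact (P y).smul_mem c (hP y hy)
  · rw [h4 y hy]
    exact (P y).zero_mem

theorem IsSubbundle.exists_section (hf : ContMDiff 𝓘(ℝ, F) 𝓘(ℝ, E) ∞ f)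
    (h : IsSubbundle (F := F) f P) {v : TangentSpace 𝓘(ℝ, E) (f x)} (hv : v ∈ P x) :
    ∃ W : ∀ x : M, TangentSpace 𝓘(ℝ, E) (f x), IsSectionOf (F := F) f P W ∧ W x = v := by
  obtain ⟨U, hU, hx, n, e, he, he'⟩ := h x
  rw [← (he' x hx).2, Submodule.mem_span_range_iff_exists_fun] at hv
  obtain ⟨c, rfl⟩ := hv
  refine exists_section_of_local (V := fun y => ∑ i, c i • e i y) hf hU hx
    (isSmoothAlongOn_of_forall fun y hy => isSmoothAlongAt_sum _ (hf y) fun i _ =>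
      ((he i).smoothAt hU hy).smul contMDiffAt_const) fun y hy => ?_
  rw [← (he' y hy).2]
  exact Submodule.sum_mem _ fun i _ => Submodule.smul_mem _ _ (Submodule.subset_span ⟨i, rfl⟩)

theorem exists_isVectorField (x : M) (v : TangentSpace 𝓘(ℝ, F) x) :
    ∃ V : ∀ y : M, TangentSpace 𝓘(ℝ, F) y, IsVectorField V ∧ V x = v := by
  have ho := (trivializationAt F (TangentSpace 𝓘(ℝ, F)) x).open_baseSet
  obtain ⟨V, h1, h2, -⟩ := exists_global_extension (f := fun y : M => y) contMDiff_id ho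
    (FiberBundle.mem_baseSet_trivializationAt' x)
    (isSmoothAlongOn_of_forall fun y hy => isSmoothAlongAt_constField (E := F) v hy)
  exact ⟨V, contMDiffOn_univ.1 h1, h2.self_of_nhds.trans (constField_self (E := F) x v)⟩

end Sections

/-! ### Algebra of the metric and differentiation of orthogonality -/

theorem SemiRiemannianMetric.sum_smul_left (g : SemiRiemannianMetric E N) {a : N} {ι : Type*}
    (s : Finset ι) (c : ι → ℝ) (e : ι → TangentSpace 𝓘(ℝ, E) a) (v : TangentSpace 𝓘(ℝ, E) a) :
    g.val a (∑ i ∈ s, c i • e i) v = ∑ i ∈ s, c i * g.val a (e i) v := by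
  rw [← g.bilin_apply, map_sum, LinearMap.sum_apply]
  exact Finset.sum_congr rfl fun i _ => by rw [map_smul, LinearMap.smul_apply, smul_eq_mul]; rfl

theorem clm_eq_zero_of_mem_span {V : Type*} [AddCommGroup V] [Module ℝ V] [TopologicalSpace V]
    {ι : Type*} {e : ι → V} {P : Submodule ℝ V} (he : Submodule.span ℝ (range e) = P)
    {A : V →L[ℝ] ℝ} (h : ∀ i, A (e i) = 0) {v : V} (hv : v ∈ P) : A v = 0 := by
  rw [← he] at hv
  induction hv using Submodule.span_induction with
  | mem v hv => obtain ⟨i, rfl⟩ := hv; exact h i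
  | zero => exact map_zero A
  | add u v _ _ hu hv => rw [map_add, hu, hv, add_zero]
  | smul c v _ hv => rw [map_smul, hv, smul_zero]

theorem SemiRiemannianMetric.nablaAlong_orthogonal [FiniteDimensional ℝ E]
    (g : SemiRiemannianMetric E N) {f : M → N}
    {V W : ∀ x : M, TangentSpace 𝓘(ℝ, E) (f x)} {x : M}
    (hV : IsSmoothAlongAt (F := F) f V x) (hW : IsSmoothAlongAt (F := F) f W x)
    (h : ∀ y, g.val (f y) (V y) (W y) = 0) (w : TangentSpace 𝓘(ℝ, F) x) :
    g.val (f x) (g.nablaAlong f V x w) (W x) = -g.val (f x) (g.nablaAlong f W x w) (V x) := by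
  have := g.mfderiv_metric hV hW w
  rw [show (fun y => g.val (f y) (V y) (W y)) = fun _ => (0 : ℝ) from funext h,
    mfderiv_const] at this
  have h0 : g.val (f x) (g.nablaAlong f V x w) (W x) +
    g.val (f x) (V x) (g.nablaAlong f W x w) = 0 := this.symm
  rw [g.symm _ (V x)] at h0
  linarith

namespace MetallicStructure

variable {p q : ℕ} {J : MetallicStructure E N p q} {g : SemiRiemannianMetric E N}

/-- For `u` in `ltr(TM)` and `v` in `Rad(TM)` only `q g(u, v)` survives, so `q ≠ 0` makes `J
ltr(TM)` and `J Rad(TM)` dually paired. -/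
theorem IsCompatible.apply_apply (hJ : J.IsCompatible g) {a : N} (u v : TangentSpace 𝓘(ℝ, E) a) :
    g.val a (J.val a u) (J.val a v) = p * g.val a u (J.val a v) + q * g.val a u v := by
  rw [hJ, J.sq, map_add, map_smul, map_smul, smul_eq_mul, smul_eq_mul]

end MetallicStructure

/-! ## Isotropic screen transversal lightlike submanifolds -/

namespace LightlikeSubmanifold

variable {g : SemiRiemannianMetric E N} (S : LightlikeSubmanifold F M g)

theorem screenTr_orthogonal_tan {x : M} {s t : TangentSpace 𝓘(ℝ, E) (S.toFun x)}
    (hs : s ∈ S.screenTr x) (ht : t ∈ S.tan x) : g.val _ s t = 0 :=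
  (S.screenTr_sup x ▸ (le_sup_left : S.screenTr x ≤ _) :
    S.screenTr x ≤ normalAlong (F := F) g S.toFun x) hs t ht

theorem ltr_subbundle : IsSubbundle (F := F) S.toFun S.ltr := fun x => by
  obtain ⟨U, hU, hx, -, η, -, hη, -⟩ := S.ltr_frame x
  exact ⟨U, hU, hx, S.r, η, hη⟩

theorem ltr_null {x : M} {u v : TangentSpace 𝓘(ℝ, E) (S.toFun x)} (hu : u ∈ S.ltr x)
    (hv : v ∈ S.ltr x) : g.val _ u v = 0 := by
  obtain ⟨U, hU, hx, ξ, η, hξ, hη, hd⟩ := S.ltr_frame x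
  refine clm_eq_zero_of_mem_span (hη.2 x hx).2 (fun j => ?_) hv
  rw [g.symm]
  refine clm_eq_zero_of_mem_span (hη.2 x hx).2 (fun i => ?_) hu
  rw [g.symm]
  exact (hd x hx i j).2

theorem push_mem_tan (W : ∀ x : M, TangentSpace 𝓘(ℝ, F) x) (x : M) : S.push W x ∈ S.tan x :=
  ⟨W x, rfl⟩

theorem exists_push_eq [FiniteDimensional ℝ F] [T2Space M] {x : M}
    {t : TangentSpace 𝓘(ℝ, E) (S.toFun x)} (ht : t ∈ S.tan x) :
    ∃ X : ∀ x : M, TangentSpace 𝓘(ℝ, F) x, IsVectorField X ∧ S.push X x = t := by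
  obtain ⟨v, rfl⟩ := ht
  obtain ⟨X, hX, hXx⟩ := exists_isVectorField x v
  exact ⟨X, hX, by rw [push, hXx]; rfl⟩

theorem smoothAt_push {X : ∀ x : M, TangentSpace 𝓘(ℝ, F) x} (hX : IsVectorField X) (x : M) :
    IsSmoothAlongAt (F := F) S.toFun (S.push X) x :=
  isSmoothAlongAt_push S.contMDiff (hX x)

section Isotropic

variable {S}

theorem IsIsotropic.rad_eq_tan (hS : S.IsIsotropic) (x : M) : S.rad x = S.tan x := by
  have := S.screen_sup x
  rwa [hS.2.2 x, bot_sup_eq] at this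

theorem IsIsotropic.isRadField (hS : S.IsIsotropic) {X : ∀ x : M, TangentSpace 𝓘(ℝ, F) x}
    (hX : IsVectorField X) : S.IsRadField X :=
  ⟨hX, fun x => hS.rad_eq_tan x ▸ S.push_mem_tan X x⟩

theorem IsIsotropic.tan_null (hS : S.IsIsotropic) {x : M}
    {u v : TangentSpace 𝓘(ℝ, E) (S.toFun x)} (hu : u ∈ S.tan x) (hv : v ∈ S.tan x) :
    g.val _ u v = 0 := by
  rw [← hS.rad_eq_tan] at hu
  exact hu.2 v hv

/-- `ltr(TM)` is null and orthogonal to `S(TM^⊥)`, so only `TM` can detect its vectors. -/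
theorem eq_zero_of_mem_ltr [FiniteDimensional ℝ E] {x : M}
    {l : TangentSpace 𝓘(ℝ, E) (S.toFun x)} (hl : l ∈ S.ltr x)
    (h : ∀ t ∈ S.tan x, g.val _ l t = 0) : l = 0 := by
  refine g.nondegenerate _ l fun v => ?_
  have hv : v ∈ S.tan x ⊔ S.ltr x ⊔ S.screenTr x := S.sup_eq_top x ▸ Submodule.mem_top
  obtain ⟨w, hw, s, hs, rfl⟩ := Submodule.mem_sup.1 hv
  obtain ⟨t, ht, l', hl', rfl⟩ := Submodule.mem_sup.1 hw
  rw [map_add, map_add, h t ht, S.ltr_null hl hl', S.ltr_orthogonal_screenTr x l hl s hs]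
  simp

/-- `TM` is orthogonal to itself and to `S(TM^⊥)`, so it sees exactly the `ltr(TM)`-part. This turns
`D^l = 0` into a metric condition. -/
theorem IsIsotropic.mem_tan_sup_screenTr [FiniteDimensional ℝ E] (hS : S.IsIsotropic) {x : M}
    {v : TangentSpace 𝓘(ℝ, E) (S.toFun x)} :
    v ∈ S.tan x ⊔ S.screenTr x ↔ ∀ t ∈ S.tan x, g.val _ v t = 0 := by
  constructor
  · intro hv t ht
    obtain ⟨t', ht', s, hs, rfl⟩ := Submodule.mem_sup.1 hv
    rw [map_add, add_apply, hS.tan_null ht' ht, S.screenTr_orthogonal_tan hs ht, add_zero]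
  · intro h
    have hv : v ∈ S.tan x ⊔ S.ltr x ⊔ S.screenTr x := S.sup_eq_top x ▸ Submodule.mem_top
    obtain ⟨w, hw, s, hs, rfl⟩ := Submodule.mem_sup.1 hv
    obtain ⟨t', ht', l, hl, rfl⟩ := Submodule.mem_sup.1 hw
    have : l = 0 := eq_zero_of_mem_ltr hl fun t ht => by
      have := h t ht
      rwa [map_add, map_add, add_apply, add_apply, hS.tan_null ht' ht,
        S.screenTr_orthogonal_tan hs ht, add_zero, zero_add] at this
    subst this
    rw [add_zero]
    exact Submodule.add_mem_sup ht' hs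

theorem IsIsotropic.mem_tan [FiniteDimensional ℝ E] (hS : S.IsIsotropic) {x : M}
    {v : TangentSpace 𝓘(ℝ, E) (S.toFun x)} (h : ∀ t ∈ S.tan x, g.val _ v t = 0)
    (h' : ∀ s ∈ S.screenTr x, g.val _ v s = 0) : v ∈ S.tan x := by
  obtain ⟨t, ht, s, hs, rfl⟩ := Submodule.mem_sup.1 (hS.mem_tan_sup_screenTr.2 h)
  have : s = 0 := S.screenTr_nondegenerate x s hs fun s' hs' => by
    have := h' s' hs'
    rwa [map_add, add_apply, g.symm _ t, S.screenTr_orthogonal_tan hs' ht, zero_add] at this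
  rwa [this, add_zero]

theorem mem_screenTr [FiniteDimensional ℝ E] {x : M}
    {v : TangentSpace 𝓘(ℝ, E) (S.toFun x)} (h : ∀ t ∈ S.tan x, g.val _ v t = 0)
    (h' : ∀ l ∈ S.ltr x, g.val _ v l = 0) : v ∈ S.screenTr x := by
  have hv : v ∈ S.screenTr x ⊔ S.rad x := by
    rw [S.screenTr_sup x]; exact h
  obtain ⟨s, hs, ρ, hρ, rfl⟩ := Submodule.mem_sup.1 hv
  -- The radical part is orthogonal to `TM` and `S(TM^⊥)` automatically, and to `ltr(TM)` by `h'`.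
  have : ρ = 0 := g.nondegenerate _ ρ fun v => by
    have hv : v ∈ S.tan x ⊔ S.ltr x ⊔ S.screenTr x := S.sup_eq_top x ▸ Submodule.mem_top
    obtain ⟨w, hw, s', hs', rfl⟩ := Submodule.mem_sup.1 hv
    obtain ⟨t, ht, l, hl, rfl⟩ := Submodule.mem_sup.1 hw
    have h1 := h' l hl
    rw [map_add, add_apply, g.symm _ s, S.ltr_orthogonal_screenTr x l hl s hs, zero_add] at h1
    rw [map_add, map_add, hρ.2 t ht, h1, g.symm _ ρ, S.screenTr_orthogonal_tan hs' hρ.1]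
    simp
  rwa [this, add_zero]

/-- The `ltr(TM)`-part of the second fundamental form of an isotropic submanifold vanishes. -/
theorem IsIsotropic.nablaAlong_push_orthogonal_tan [FiniteDimensional ℝ E] [FiniteDimensional ℝ F]
    [T2Space M] (hS : S.IsIsotropic) {U : ∀ x : M, TangentSpace 𝓘(ℝ, F) x} (hU : IsVectorField U)
    (x : M) (w : TangentSpace 𝓘(ℝ, F) x) {t : TangentSpace 𝓘(ℝ, E) (S.toFun x)}
    (ht : t ∈ S.tan x) : g.val _ (g.nablaAlong S.toFun (S.push U) x w) t = 0 := by
  obtain ⟨H, hH, hH'⟩ := exists_symm_nablaAlong_push S.contMDiff g x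
  -- The tangent remainder disappears against the null space `TM`.
  have key : ∀ X : (∀ x : M, TangentSpace 𝓘(ℝ, F) x), IsVectorField X → ∀ a, ∀ v ∈ S.tan x,
      g.val _ (g.nablaAlong S.toFun (S.push X) x a) v = g.val _ (H a (X x)) v := by
    intro X hX a v hv
    obtain ⟨t, ht, h⟩ := hH' X hX a
    rw [show g.nablaAlong S.toFun (S.push X) x a = t + H a (X x) from h, map_add,
      add_apply, hS.tan_null ht hv, zero_add]
  let d : TangentSpace 𝓘(ℝ, F) x → TangentSpace 𝓘(ℝ, E) (S.toFun x) :=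
    fun a => mfderiv 𝓘(ℝ, F) 𝓘(ℝ, E) S.toFun x a
  have skew : ∀ a b c, g.val _ (H a b) (d c) = -g.val _ (H a c) (d b) := by
    intro a b c
    obtain ⟨B, hB, hBx⟩ := exists_isVectorField x b
    obtain ⟨C, hC, hCx⟩ := exists_isVectorField x c
    have h := g.nablaAlong_orthogonal (S.smoothAt_push hB x) (S.smoothAt_push hC x)
      (fun y => hS.tan_null (S.push_mem_tan B y) (S.push_mem_tan C y)) a
    rw [key B hB a _ (S.push_mem_tan C x), key C hC a _ (S.push_mem_tan B x)] at h
    simp only [push, hBx, hCx] at h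
    exact h
  obtain ⟨c, rfl⟩ := ht
  refine (key U hU w _ ⟨c, rfl⟩).trans ?_
  -- A form symmetric in its first two and skew in its last two arguments equals its own negative
  -- after six alternating swaps.
  have h1 := skew w (U x) c
  have h2 := skew c w (U x)
  have h3 := skew (U x) c w
  rw [hH w c] at h1
  rw [hH c (U x)] at h2
  rw [hH (U x) w] at h3
  change g.val _ _ (d c) = 0
  linarith

end Isotropic

end LightlikeSubmanifold

namespace LightlikeSubmanifold

variable {g : SemiRiemannianMetric E N} {S : LightlikeSubmanifold F M g}
  {p q : ℕ} {J : MetallicStructure E N p q}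

section ScreenTransversal

theorem metallic_mem_screenTr (hS : S.IsIsotropic) (hst : S.IsScreenTransversal J) {x : M}
    {t : TangentSpace 𝓘(ℝ, E) (S.toFun x)} (ht : t ∈ S.tan x) :
    J.val _ t ∈ S.screenTr x :=
  hst x t (hS.rad_eq_tan x ▸ ht)

theorem metallic_tan_orthogonal_tan (hS : S.IsIsotropic) (hst : S.IsScreenTransversal J) {x : M}
    {t t' : TangentSpace 𝓘(ℝ, E) (S.toFun x)} (ht : t ∈ S.tan x) (ht' : t' ∈ S.tan x) :
    g.val _ t (J.val _ t') = 0 := by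
  rw [g.symm]
  exact S.screenTr_orthogonal_tan (metallic_mem_screenTr hS hst ht') ht

theorem metallic_tan_orthogonal_ltr (hS : S.IsIsotropic) (hst : S.IsScreenTransversal J) {x : M}
    {l t : TangentSpace 𝓘(ℝ, E) (S.toFun x)} (hl : l ∈ S.ltr x) (ht : t ∈ S.tan x) :
    g.val _ l (J.val _ t) = 0 :=
  S.ltr_orthogonal_screenTr x l hl _ (metallic_mem_screenTr hS hst ht)

/-- The component in `D₀` of a vector of `S(TM^⊥)`. -/
theorem mem_D₀_of_frame [FiniteDimensional ℝ E] (hJ : J.IsCompatible g) (hS : S.IsIsotropic)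
    (hst : S.IsScreenTransversal J) {x : M} {ι : Type*} [Fintype ι] [DecidableEq ι]
    {ξ η : ι → TangentSpace 𝓘(ℝ, E) (S.toFun x)}
    (hξ : Submodule.span ℝ (range ξ) = S.rad x) (hη : Submodule.span ℝ (range η) = S.ltr x)
    (hd : ∀ i j, g.val _ (η i) (ξ j) = if i = j then 1 else 0)
    {z : TangentSpace 𝓘(ℝ, E) (S.toFun x)} (hz : z ∈ S.screenTr x) {a b c : ι → ℝ}
    (hb : ∀ k, q * b k = g.val _ z (J.val _ (ξ k)))
    (hc : ∀ k, c k = g.val _ (J.val _ (∑ i, b i • η i)) (η k))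
    (ha : ∀ k, q * a k = g.val _ z (J.val _ (η k)) -
      g.val _ (J.val _ (∑ i, b i • η i)) (J.val _ (η k))) :
    z - J.val _ (∑ i, a i • ξ i) - J.val _ (∑ i, b i • η i) + ∑ i, c i • ξ i ∈ S.D₀ J x := by
  have hξm : ∀ i, ξ i ∈ S.tan x := fun i => by
    rw [← hS.rad_eq_tan, ← hξ]; exact Submodule.subset_span ⟨i, rfl⟩
  have hηm : ∀ i, η i ∈ S.ltr x := fun i => by
    rw [← hη]; exact Submodule.subset_span ⟨i, rfl⟩
  have hAm : ∀ a : ι → ℝ, ∑ i, a i • ξ i ∈ S.tan x := fun a =>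
    Submodule.sum_mem _ fun i _ => Submodule.smul_mem _ _ (hξm i)
  have hBm : ∑ i, b i • η i ∈ S.ltr x :=
    Submodule.sum_mem _ fun i _ => Submodule.smul_mem _ _ (hηm i)
  have hAη : ∀ (a : ι → ℝ) k, g.val _ (∑ i, a i • ξ i) (η k) = a k := fun a k => by
    rw [g.sum_smul_left]
    simp [g.symm _ (ξ _), hd]
  have hBξ : ∀ k, g.val _ (∑ i, b i • η i) (ξ k) = b k := fun k => by
    rw [g.sum_smul_left]
    simp [hd]
  set A := ∑ i, a i • ξ i
  set B := ∑ i, b i • η i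
  set C := ∑ i, c i • ξ i
  have expand : ∀ v, g.val _ (z - J.val _ A - J.val _ B + C) v =
      g.val _ z v - g.val _ (J.val _ A) v - g.val _ (J.val _ B) v + g.val _ C v := fun v => by
    rw [map_add, map_sub, map_sub]
    rfl
  refine ⟨mem_screenTr (fun t ht => ?_) (fun l hl => ?_), fun v hv => ?_, fun v hv => ?_⟩
  · rw [expand, S.screenTr_orthogonal_tan hz ht,
      S.screenTr_orthogonal_tan (metallic_mem_screenTr hS hst (hAm a)) ht, hJ,
      metallic_tan_orthogonal_ltr hS hst hBm ht, hS.tan_null (hAm c) ht]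
    ring
  -- This fixes `c`: `C` removes the radical part of `J B`.
  · refine clm_eq_zero_of_mem_span hη (fun k => ?_) hl
    rw [expand, g.symm _ z, S.ltr_orthogonal_screenTr x _ (hηm k) z hz, g.symm _ (J.val _ A),
      metallic_tan_orthogonal_ltr hS hst (hηm k) (hAm a), ← hc, hAη]
    ring
  -- This fixes `b`: `J A` and `C` are orthogonal to `J Rad(TM)`, and `g(JB, Jξ_k) = q b_k`.
  · have hz0 : ∀ k, g.val _ (z - J.val _ A - J.val _ B + C) (J.val _ (ξ k)) = 0 := fun k => by
      rw [expand, ← hb, hJ.apply_apply, hJ.apply_apply,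
        metallic_tan_orthogonal_tan hS hst (hAm a) (hξm k), hS.tan_null (hAm a) (hξm k),
        metallic_tan_orthogonal_ltr hS hst hBm (hξm k), hBξ,
        metallic_tan_orthogonal_tan hS hst (hAm c) (hξm k)]
      ring
    exact clm_eq_zero_of_mem_span (A := (g.val _ (z - J.val _ A - J.val _ B + C)).comp (J.val _))
      hξ hz0 hv
  -- This fixes `a`: `g(JA, Jη_k) = q a_k`, while `J B` contributes because `J ltr(TM)` need not be
  -- null.
  · have hz0 : ∀ k, g.val _ (z - J.val _ A - J.val _ B + C) (J.val _ (η k)) = 0 := fun k => by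
      have h1 : g.val _ (J.val _ A) (η k) = 0 := by
        rw [g.symm]; exact metallic_tan_orthogonal_ltr hS hst (hηm k) (hAm a)
      have h2 : g.val _ (J.val _ C) (η k) = 0 := by
        rw [g.symm]; exact metallic_tan_orthogonal_ltr hS hst (hηm k) (hAm c)
      rw [expand, hJ.apply_apply, ← hJ _ A, h1, hAη, ← hJ _ C, h2, ha]
      ring
    exact clm_eq_zero_of_mem_span (A := (g.val _ (z - J.val _ A - J.val _ B + C)).comp (J.val _))
      hη hz0 hv

/-- Through every vector of `S(TM^⊥)` there passes a section of `D₀`, up to `J Rad(TM)`,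
`J ltr(TM)` and `Rad(TM)`. -/
theorem exists_D₀_section [FiniteDimensional ℝ E] [FiniteDimensional ℝ F] [T2Space M]
    (hJ : J.IsCompatible g) (hS : S.IsIsotropic) (hst : S.IsScreenTransversal J) {x : M}
    {z : TangentSpace 𝓘(ℝ, E) (S.toFun x)} (hz : z ∈ S.screenTr x) :
    ∃ Z, IsSectionOf (F := F) S.toFun (S.D₀ J) Z ∧ ∃ t ∈ S.tan x, ∃ l ∈ S.ltr x, ∃ t' ∈ S.tan x,
      z = Z x + J.val _ t + J.val _ l + t' := by
  obtain ⟨V, hV, rfl⟩ := S.screenTr_subbundle.exists_section S.contMDiff hz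
  obtain ⟨U, hU, hx, ξ, η, hξ, hη, hd⟩ := S.ltr_frame x
  have hq : (q : ℝ) ≠ 0 := Nat.cast_ne_zero.2 J.q_pos.ne'
  -- The system is triangular: `b` comes first, and `c` and `a` depend on `B`. Explicit formulas
  -- make the correction of `V` into `D₀` smooth, so no local frame of `D₀` is required.
  let b : Fin S.r → M → ℝ := fun k y => (q : ℝ)⁻¹ * g.val _ (V y) (J.val _ (ξ k y))
  let B : ∀ y : M, TangentSpace 𝓘(ℝ, E) (S.toFun y) := fun y => ∑ i, b i y • η i y
  let c : Fin S.r → M → ℝ := fun k y => g.val _ (J.val _ (B y)) (η k y)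
  let a : Fin S.r → M → ℝ := fun k y => (q : ℝ)⁻¹ * (g.val _ (V y) (J.val _ (η k y)) -
    g.val _ (J.val _ (B y)) (J.val _ (η k y)))
  let A : ∀ y : M, TangentSpace 𝓘(ℝ, E) (S.toFun y) := fun y => ∑ i, a i y • ξ i y
  let C : ∀ y : M, TangentSpace 𝓘(ℝ, E) (S.toFun y) := fun y => ∑ i, c i y • ξ i y
  have smooth : IsSmoothAlongOn (F := F) S.toFun
      (fun y => V y - J.val _ (A y) - J.val _ (B y) + C y) U := by
    refine isSmoothAlongOn_of_forall fun y hy => ?_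
    have sV : IsSmoothAlongAt (F := F) S.toFun V y := hV.1.smoothAt isOpen_univ (mem_univ y)
    have sξ := fun i => (hξ.1 i).smoothAt hU hy
    have sη := fun i => (hη.1 i).smoothAt hU hy
    have sb : ∀ i, ContMDiffAt 𝓘(ℝ, F) 𝓘(ℝ, ℝ) ∞ (b i) y := fun i =>
      contMDiffAt_const.mul (sV.metric g ((sξ i).metallic J))
    have sB : IsSmoothAlongAt (F := F) S.toFun B y :=
      isSmoothAlongAt_sum _ (S.contMDiff y) fun i _ => (sη i).smul (sb i)
    have sc : ∀ i, ContMDiffAt 𝓘(ℝ, F) 𝓘(ℝ, ℝ) ∞ (c i) y := fun i =>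
      (sB.metallic J).metric g (sη i)
    have sa : ∀ i, ContMDiffAt 𝓘(ℝ, F) 𝓘(ℝ, ℝ) ∞ (a i) y := fun i =>
      contMDiffAt_const.mul ((sV.metric g ((sη i).metallic J)).sub
        ((sB.metallic J).metric g ((sη i).metallic J)))
    have sA : IsSmoothAlongAt (F := F) S.toFun A y :=
      isSmoothAlongAt_sum _ (S.contMDiff y) fun i _ => (sξ i).smul (sa i)
    have sC : IsSmoothAlongAt (F := F) S.toFun C y :=
      isSmoothAlongAt_sum _ (S.contMDiff y) fun i _ => (sξ i).smul (sc i)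
    exact ((sV.sub (sA.metallic J)).sub (sB.metallic J)).add sC
  obtain ⟨Z, hZ, hZx⟩ := exists_section_of_local (P := S.D₀ J) S.contMDiff hU hx smooth
    fun y hy => mem_D₀_of_frame (a := fun i => a i y) (b := fun i => b i y) (c := fun i => c i y)
      hJ hS hst (hξ.2 y hy).2 (hη.2 y hy).2 (fun i j => (hd y hy i j).1) (hV.2 y)
      (fun k => mul_inv_cancel_left₀ hq _) (fun k => rfl) (fun k => mul_inv_cancel_left₀ hq _)
  have hr : Submodule.span ℝ (range fun i => ξ i x) = S.rad x := (hξ.2 x hx).2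
  have hm : ∀ e : Fin S.r → ℝ, ∑ i, e i • ξ i x ∈ S.tan x := fun e =>
    Submodule.sum_mem _ fun i _ => Submodule.smul_mem _ _ (by
      rw [← hS.rad_eq_tan, ← hr]; exact Submodule.subset_span ⟨i, rfl⟩)
  refine ⟨Z, hZ, A x, hm _, B x, Submodule.sum_mem _ fun i _ => Submodule.smul_mem _ _ (by
      rw [← (hη.2 x hx).2]; exact Submodule.subset_span ⟨i, rfl⟩), -C x,
    Submodule.neg_mem _ (hm _), ?_⟩
  rw [hZx]
  abel

end ScreenTransversal

/-- The discarded part lies in `TM ⊕ ltr(TM)`, which is orthogonal to `S(TM^⊥)`. Thus `D^s(W, η)`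
may be replaced by `∇_W η` in condition (3). -/
theorem projScreenTr_metric [FiniteDimensional ℝ E] {x : M}
    (v : TangentSpace 𝓘(ℝ, E) (S.toFun x)) {s : TangentSpace 𝓘(ℝ, E) (S.toFun x)}
    (hs : s ∈ S.screenTr x) : g.val _ (S.projScreenTr x v) s = g.val _ v s := by
  have h := Submodule.projection_add_projection_eq_self (S.isCompl_screenTr x) v
  have hm := Submodule.projection_apply_mem (S.isCompl_screenTr x).symm v
  obtain ⟨t, ht, l, hl, e⟩ := Submodule.mem_sup.1 hm
  have h2 : g.val _ (Submodule.projection _ _ (S.isCompl_screenTr x).symm v) s = 0 := by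
    rw [← e, map_add, add_apply, g.symm _ t, S.screenTr_orthogonal_tan hs ht,
      S.ltr_orthogonal_screenTr x l hl s hs, add_zero]
  conv_rhs => rw [← h]
  rw [map_add, add_apply, h2, add_zero]
  rfl

end LightlikeSubmanifold

end Along
end

/-! ### The characterization of totally geodesic submanifolds -/

theorem mainTheorem8
    {E : Type*} [NormedAddCommGroup E] [NormedSpace ℝ E] [FiniteDimensional ℝ E]
    {N : Type*} [TopologicalSpace N] [ChartedSpace E N] [IsManifold 𝓘(ℝ, E) ∞ N] [T2Space N]
    {F : Type*} [NormedAddCommGroup F] [NormedSpace ℝ F] [FiniteDimensional ℝ F]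
    {M : Type*} [TopologicalSpace M] [ChartedSpace F M] [IsManifold 𝓘(ℝ, F) ∞ M] [T2Space M]
    {p q : ℕ} (g : SemiRiemannianMetric E N) (J : MetallicStructure E N p q)
    (hJ : J.IsLocallyMetallic g) (S : LightlikeSubmanifold F M g)
    (hiso : S.IsIsotropic) (hst : S.IsScreenTransversal J) :
    S.IsTotallyGeodesic ↔
      (∀ ξ₁ ξ₂ : (∀ x : M, TangentSpace 𝓘(ℝ, F) x), S.IsRadField ξ₁ → S.IsRadField ξ₂ →
        ∀ x, S.Dl ξ₁ (fun y => J.val (S.toFun y) (S.push ξ₂ y)) x = 0) ∧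
      (∀ (ξ₁ : ∀ x : M, TangentSpace 𝓘(ℝ, F) x)
        (Z : ∀ x : M, TangentSpace 𝓘(ℝ, E) (S.toFun x)), S.IsRadField ξ₁ →
        IsSectionOf (F := F) S.toFun (S.D₀ J) Z → ∀ x, S.Dl ξ₁ Z x = 0) ∧
      (∀ (ξ₁ : ∀ x : M, TangentSpace 𝓘(ℝ, F) x)
        (η : ∀ x : M, TangentSpace 𝓘(ℝ, E) (S.toFun x)), S.IsRadField ξ₁ →
        IsSectionOf (F := F) S.toFun S.ltr η → S.HasNoJRadComponent J (S.Ds ξ₁ η)) := by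
  have h_iff : ∀ W U : (∀ x : M, TangentSpace 𝓘(ℝ, F) x), ∀ x,
      S.h W U x = 0 ↔ g.nablaAlong S.toFun (S.push U) x (W x) ∈ S.tan x := fun W U x =>
    Submodule.projection_apply_eq_zero_iff _
  have Dl_iff : ∀ (W : ∀ x : M, TangentSpace 𝓘(ℝ, F) x)
      (Z : ∀ x : M, TangentSpace 𝓘(ℝ, E) (S.toFun x)) (x : M), S.Dl W Z x = 0 ↔
      ∀ t ∈ S.tan x, g.val _ (g.nablaAlong S.toFun Z x (W x)) t = 0 := fun W Z x =>
    (Submodule.projection_apply_eq_zero_iff _).trans hiso.mem_tan_sup_screenTr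
  -- the three conditions in terms of the metric
  have eq1 : ∀ U : (∀ x : M, TangentSpace 𝓘(ℝ, F) x), IsVectorField U → ∀ x w t,
      g.val _ (g.nablaAlong S.toFun (fun y => J.val _ (S.push U y)) x w) t =
        g.val _ (g.nablaAlong S.toFun (S.push U) x w) (J.val _ t) := fun U hU x w t => by
    rw [hJ.2.nablaAlong (S.smoothAt_push hU x), hJ.1]
  have eq2 : ∀ U : (∀ x : M, TangentSpace 𝓘(ℝ, F) x), IsVectorField U →
      ∀ Z, IsSectionOf (F := F) S.toFun (S.D₀ J) Z → ∀ x w,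
      g.val _ (g.nablaAlong S.toFun Z x w) (S.push U x) =
        -g.val _ (g.nablaAlong S.toFun (S.push U) x w) (Z x) := fun U hU Z hZ x w =>
    g.nablaAlong_orthogonal (hZ.1.smoothAt isOpen_univ (mem_univ x)) (S.smoothAt_push hU x)
      (fun y => S.screenTr_orthogonal_tan (hZ.2 y).1 (S.push_mem_tan U y)) w
  have eq3 : ∀ U : (∀ x : M, TangentSpace 𝓘(ℝ, F) x), IsVectorField U →
      ∀ (W : ∀ x : M, TangentSpace 𝓘(ℝ, F) x) η, IsSectionOf (F := F) S.toFun S.ltr η → ∀ x,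
      g.val _ (S.Ds W η x) (J.val _ (S.push U x)) =
        -g.val _ (g.nablaAlong S.toFun (S.push U) x (W x)) (J.val _ (η x)) := by
    intro U hU W η hη x
    have hs : IsSmoothAlongAt (F := F) S.toFun η x := hη.1.smoothAt isOpen_univ (mem_univ x)
    refine (LightlikeSubmanifold.projScreenTr_metric _
      (LightlikeSubmanifold.metallic_mem_screenTr hiso hst (S.push_mem_tan U x))).trans ?_
    -- `g(∇_W η, JU) = g(∇_W (Jη), U)`, and the derivative then passes to `U` because `g(Jη, U) =
    -- g(η, JU) = 0`.
    rw [← hJ.1, ← hJ.2.nablaAlong hs]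
    refine g.nablaAlong_orthogonal (hs.metallic J) (S.smoothAt_push hU x) (fun y => ?_) _
    rw [hJ.1]
    exact LightlikeSubmanifold.metallic_tan_orthogonal_ltr hiso hst (hη.2 y) (S.push_mem_tan U y)
  constructor
  · intro hg
    have hm : ∀ W U : (∀ x : M, TangentSpace 𝓘(ℝ, F) x), IsVectorField W → IsVectorField U →
      ∀ x, g.nablaAlong S.toFun (S.push U) x (W x) ∈ S.tan x := fun W U hW hU x =>
      (h_iff W U x).1 (hg W U hW hU x)
    refine ⟨fun W U hW hU x => (Dl_iff _ _ _).2 fun t ht => ?_,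
      fun W Z hW hZ x => (Dl_iff _ _ _).2 fun t ht => ?_, fun W η hW hη x v hv => ?_⟩
    · rw [eq1 U hU.1]
      exact LightlikeSubmanifold.metallic_tan_orthogonal_tan hiso hst (hm W U hW.1 hU.1 x) ht
    · obtain ⟨U, hU, rfl⟩ := S.exists_push_eq ht
      rw [eq2 U hU Z hZ, g.symm, S.screenTr_orthogonal_tan (hZ.2 x).1 (hm W U hW.1 hU x), neg_zero]
    · rw [hiso.rad_eq_tan] at hv
      obtain ⟨U, hU, rfl⟩ := S.exists_push_eq hv
      rw [eq3 U hU W η hη, ← hJ.1, g.symm,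
        LightlikeSubmanifold.metallic_tan_orthogonal_ltr hiso hst (hη.2 x) (hm W U hW.1 hU x),
        neg_zero]
  · rintro ⟨h1, h2, h3⟩ W U hW hU x
    rw [h_iff]
    have hWr := hiso.isRadField hW
    have hUr := hiso.isRadField hU
    -- The `ltr(TM)`-part vanishes for any isotropic `M`; the three conditions are needed only
    -- against `S(TM^⊥)`.
    refine hiso.mem_tan (fun t ht => hiso.nablaAlong_push_orthogonal_tan hU x (W x) ht)
      fun s hs => ?_
    obtain ⟨Z, hZ, t, ht, l, hl, t', ht', rfl⟩ :=
      LightlikeSubmanifold.exists_D₀_section hJ.1 hiso hst hs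
    obtain ⟨η, hη, rfl⟩ := S.ltr_subbundle.exists_section S.contMDiff hl
    have e1 := (Dl_iff _ _ _).1 (h1 W U hWr hUr x) t ht
    have e2 := (Dl_iff _ _ _).1 (h2 W Z hWr hZ x) _ (S.push_mem_tan U x)
    have e3 := h3 W η hWr hη x _ (hUr.2 x)
    rw [eq1 U hU] at e1
    rw [eq2 U hU Z hZ, neg_eq_zero] at e2
    rw [eq3 U hU W η hη, neg_eq_zero] at e3
    rw [map_add, map_add, map_add, e1, e2, e3,
      hiso.nablaAlong_push_orthogonal_tan hU x (W x) ht']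
    simp
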